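/- Call $X'\subseteq\mathbb{R}^2$ \emph{normalized anchored} if $X'\subseteq U:=[0,1]\times(0,1)$ and for every $\epsilon\in(0,1)$ there is a closed axis-aligned square $E\subset U$ of side length $\xi>0$, $E=[x,x+\xi]\times[y,y+\xi]$, such that (i) $E\cap X'=\emptyset$, $(1+\epsilon)\xi<\epsilon$, and the distance $1-(x+\xi)$ between the right side of $E$ and the right side of $U$ equals $\epsilon\xi$; (ii) (left $\epsilon$-stabber) $X'$ contains a curve that lies in $[0,x]\times(0,1)$ and connects the line $\{0\}\times\mathbb{R}$ with the line $\{x\}\times\mathbb{R}$; (iii) (right $\epsilon$-stabber) $X'$ contains a curve that lies in $[x+\xi,1]\times[y,y+\xi]$ and connects the bottom side of this rectangle with its top side. Call $X\subseteq\mathbb{R}^2$ \emph{anchored} if some invertible affine transformation of the plane maps $X$ onto a normalized anchored set. A \emph{homothetic copy} of $X$ is a set $rX+v$ with $r>0$ and $v\in\mathbb{R}^2$. The \emph{intersection graph} of a family $\mathcal{F}$ of sets has the members of $\mathcal{F}$ as its vertices, two different members being adjacent if and only if they intersect; $\mathcal{F}$ is \emph{triangle-free} if this graph has no three pairwise adjacent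 vertices, and $\chi(\mathcal{F})$ is the chromatic number of this graph. \textbf{Theorem.} For every anchored set $X\subseteq\mathbb{R}^2$ and every integer $k\ge 1$ there is a finite triangle-free family $\mathcal{F}$ of homothetic copies of $X$ such that $\chi(\mathcal{F})>k$. Moreover, the following sets are anchored: every circle of positive radius, the boundary of every (nondegenerate) square, and every equilateral L-shape, that is, every union of two perpendicular segments of the same positive length with a common endpoint. -/

import Mathlib

open Set

namespace HomotheticCopies

/-- The closed axis-aligned rectangle `[a, b] × [c, d]`. -/
def rect (a b c d : ℝ) : Set (ℝ × ℝ) := Icc a b ×ˢ Icc c d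

/-- `X` contains a curve that stabs the rectangle `[a, b] × [c, d]` horizontally: the curve lies in
the rectangle and joins a point of its left side to a point of its right side. -/
def ContainsHorizontalStabber (X : Set (ℝ × ℝ)) (a b c d : ℝ) : Prop :=
  ∃ p q : ℝ × ℝ, p.1 = a ∧ q.1 = b ∧ JoinedIn (X ∩ rect a b c d) p q

/-- `X` contains a curve that stabs the rectangle `[a, b] × [c, d]` vertically: the curve lies in
the rectangle and joins a point of its bottom side to a point of its top side. -/
def ContainsVerticalStabber (X : Set (ℝ × ℝ)) (a b c d : ℝ) : Prop :=
  ∃ p q : ℝ × ℝ, p.2 = c ∧ q.2 = d ∧ JoinedIn (X ∩ rect a b c d) p q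

/-- The bounding square `[0, 1] × (0, 1)`, open at the top and at the bottom. -/
def boundingSquare : Set (ℝ × ℝ) := Icc 0 1 ×ˢ Ioo 0 1

/-- `X` is anchored and in the normalized position. For each `ε`, the `ε`-empty square is
`[x, x + ξ] × [y, y + ξ]`. As `X` lies in the bounding square, it makes no difference whether the
rectangle of the left stabber contains its top and bottom sides. -/
structure IsAnchoredNormalized (X : Set (ℝ × ℝ)) : Prop where
  subset_boundingSquare : X ⊆ boundingSquare
  exists_empty_square : ∀ ε : ℝ, 0 < ε → ε < 1 → ∃ x y ξ : ℝ, 0 < ξ ∧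
    rect x (x + ξ) y (y + ξ) ⊆ boundingSquare ∧
    Disjoint (rect x (x + ξ) y (y + ξ)) X ∧
    (1 + ε) * ξ < ε ∧
    1 - (x + ξ) = ε * ξ ∧
    ContainsHorizontalStabber X 0 x 0 1 ∧
    ContainsVerticalStabber X (x + ξ) 1 y (y + ξ)

/-- `X` is anchored: some invertible affine transformation of the plane takes it to the
normalized position. -/
def IsAnchored (X : Set (ℝ × ℝ)) : Prop :=
  ∃ T : (ℝ × ℝ) ≃ᵃ[ℝ] (ℝ × ℝ), IsAnchoredNormalized (T '' X)

/-- `Y` is a homothetic copy of `X`: it arises from `X` by uniform scaling (with a positive factor)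
and translation. -/
def IsHomotheticCopy (X Y : Set (ℝ × ℝ)) : Prop :=
  ∃ (r : ℝ) (v : ℝ × ℝ), 0 < r ∧ Y = (fun p => r • p + v) '' X

/-- The intersection graph of a family of sets: the vertices are the members of the family, and two
different members are adjacent if and only if they intersect. -/
def intersectionGraph (F : Set (Set (ℝ × ℝ))) : SimpleGraph F where
  Adj A B := A ≠ B ∧ ((A : Set (ℝ × ℝ)) ∩ (B : Set (ℝ × ℝ))).Nonempty
  symm := ⟨fun A B h => ⟨h.1.symm, by rw [inter_comm]; exact h.2⟩⟩
  loopless := ⟨fun _ h => h.1 rfl⟩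

/-- The circle with center `c` and radius `r`, for the Euclidean distance. -/
def circle (c : ℝ × ℝ) (r : ℝ) : Set (ℝ × ℝ) :=
  {p | (p.1 - c.1) ^ 2 + (p.2 - c.2) ^ 2 = r ^ 2}

/-- The vector `w` turned by a right angle counterclockwise. -/
def turn (w : ℝ × ℝ) : ℝ × ℝ := (-w.2, w.1)

/-- The boundary of the square with center `c`, one of whose sides has the midpoint `c + w`. -/
def squareBoundary (c w : ℝ × ℝ) : Set (ℝ × ℝ) :=
  {p | ∃ a b : ℝ, max |a| |b| = 1 ∧ p = c + a • w + b • turn w}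

/-- The equilateral L-shape with corner `c`: two perpendicular segments of equal length that share
the end `c`. -/
def equilateralL (c w : ℝ × ℝ) : Set (ℝ × ℝ) :=
  segment ℝ c (c + w) ∪ segment ℝ c (c + turn w)

end HomotheticCopies

/-! The argument is a Burling-type induction. A probe is a thin rectangle reaching the line `{1} ×
ℝ`. Its left end, the root, avoids the family. The members meeting the probe are pairwise disjoint,
and each crosses it vertically to the right of the root. The induction on `k` builds, for every `ε`,
a finite triangle-free family with probes of disjoint height ranges such that every proper coloring
shows at least `k` colors on some probe. The part of a probe beyond its root is at most `ε` times as
wide as the probe is high.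

For the step, contract a family forcing `k` so that a strip of width `δ` on the right becomes free,
and add to each probe `Q` a copy `D` of `X`, its diagonal, in the upper half of `Q`. The left
stabber of `D` must cross everything that crosses `Q` (`IsSpaced.diagonal_stabs`), so the color of
`D` is new on `Q`. Then `Q` splits into a lower probe missing `D` and an upper probe, rooted in the
empty square of `D`, that meets only `D`. Given any set `B` of at least `k` colors, one of the two
gains a color: the lower probe if the color of `D` is in `B`, the upper one otherwise
(`IsSpaced.forcesBeyond_withDiagonals`).

Finally, place this gadget in the root of every probe of a second family forcing `k`. On a probe `P`
already showing `k` colors, take these as `B`; the nested probe is crossed by the old members and by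
the gadget, hence shows `k + 1` colors (`forces_nest`). An affine map transfers the result from
normalized to anchored sets. -/

namespace HomotheticCopies

/-! ### Crossing curves, by winding numbers -/

/-- A continuous angle whose sine stays nonnegative remains in `[0, π]`. -/
lemma mem_Icc_of_sin_nonneg {v : ℝ → ℝ} (hv : Continuous v) (hs : ∀ t, 0 ≤ Real.sin (v t))
    (h0 : v 0 ∈ Icc 0 Real.pi) (t : ℝ) : v t ∈ Icc 0 Real.pi := by
  have hpi := Real.pi_pos
  have key : ∀ y, 0 < y → y < Real.pi → ∀ t, v t ≠ Real.pi + y ∧ v t ≠ -y := by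
    intro y hy hy' t
    have h1 := Real.sin_pos_of_pos_of_lt_pi hy hy'
    constructor <;> intro h <;> have h2 := hs t <;> rw [h] at h2
    · rw [add_comm, Real.sin_add_pi] at h2; linarith
    · rw [Real.sin_neg] at h2; linarith
  by_contra hcon
  have hmem := fun y (hy : y ∈ uIcc (v 0) (v t)) =>
    intermediate_value_uIcc (hv.continuousOn (s := uIcc 0 t)) hy
  rw [mem_Icc, not_and_or, not_le, not_le] at hcon
  rcases hcon with h | h
  · have hm : 0 < min (-(v t)) (Real.pi / 2) := lt_min (by linarith) (by linarith)
    obtain ⟨u, -, hu⟩ := hmem (-(min (-(v t)) (Real.pi / 2))) (by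
      rw [mem_uIcc]; right
      exact ⟨by linarith [min_le_left (-(v t)) (Real.pi / 2)], by linarith [h0.1]⟩)
    exact (key _ hm (by linarith [min_le_right (-(v t)) (Real.pi / 2)]) u).2 hu
  · have hm : 0 < min (v t - Real.pi) (Real.pi / 2) := lt_min (by linarith) (by linarith)
    obtain ⟨u, -, hu⟩ := hmem (Real.pi + (min (v t - Real.pi) (Real.pi / 2))) (by
      rw [mem_uIcc]; left
      exact ⟨by linarith [h0.2], by linarith [min_le_left (v t - Real.pi) (Real.pi / 2)]⟩)
    exact (key _ hm (by linarith [min_le_right (v t - Real.pi) (Real.pi / 2)]) u).1 hu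

/-- Used at a corner of the parameter square: two sign conditions hold there at once, so the
half-turn window confining the angle can advance by a quarter turn. -/
lemma sub_pi_div_two_mem_Icc {v : ℝ} (hv : v ∈ Icc 0 Real.pi)
    (hs : 0 ≤ Real.sin (v - Real.pi / 2)) : v - Real.pi / 2 ∈ Icc 0 Real.pi := by
  have hpi := Real.pi_pos
  refine ⟨?_, by linarith [hv.2]⟩
  by_contra h
  exact absurd hs (not_le.2 (Real.sin_neg_of_neg_of_neg_pi_lt (by linarith) (by linarith [hv.1])))

/-- A curve going from left to right meets a curve going from bottom to top. -/
theorem exists_path_eq_path {p q p' q' : ℝ × ℝ} (f : Path p q) (g : Path p' q')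
    (hl : ∀ t, p.1 ≤ (g t).1) (hr : ∀ t, (g t).1 ≤ q.1)
    (hb : ∀ s, p'.2 ≤ (f s).2) (ht : ∀ s, (f s).2 ≤ q'.2) : ∃ s t, f s = g t := by
  by_contra hne
  push Not at hne
  let Φ : C(ℝ × ℝ, ℂ) := ⟨fun z => Complex.equivRealProdCLM.symm (f.extend z.1 - g.extend z.2), by
    fun_prop⟩
  have hre : ∀ s t, (Φ (s, t)).re = (f.extend s).1 - (g.extend t).1 := fun s t => by
    simp [Φ]
  have him : ∀ s t, (Φ (s, t)).im = (f.extend s).2 - (g.extend t).2 := fun s t => by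
    simp [Φ]
  have hΦ : ∀ z, Φ z ≠ 0 := by
    intro z hz
    have : f.extend z.1 - g.extend z.2 = 0 := Complex.equivRealProdCLM.symm.map_eq_zero_iff.1 hz
    exact hne _ _ (sub_eq_zero.1 this)
  -- The parameter plane is simply connected, so the nonvanishing difference of the two curves has a
  -- continuous logarithm.
  obtain ⟨L, ⟨hL0, hL⟩, -⟩ := Complex.isCoveringMapOn_exp.existsUnique_continuousMap_lifts Φ
    (a₀ := (0, 0)) (e₀ := Complex.log (Φ (0, 0))) (Complex.exp_log (hΦ _)) (fun a => hΦ a)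
  have hL' : ∀ z, Complex.exp (L z) = Φ z := fun z => congrFun hL z
  have hsin : ∀ z, (Φ z).im = Real.exp (L z).re * Real.sin (L z).im := fun z => by
    rw [← hL', Complex.exp_im]
  have hcos : ∀ z, (Φ z).re = Real.exp (L z).re * Real.cos (L z).im := fun z => by
    rw [← hL', Complex.exp_re]
  have sin_nonneg : ∀ z, 0 ≤ (Φ z).im → 0 ≤ Real.sin (L z).im := fun z h =>
    nonneg_of_mul_nonneg_right (hsin z ▸ h) (Real.exp_pos _)
  have sin_nonpos : ∀ z, (Φ z).im ≤ 0 → 0 ≤ -Real.sin (L z).im := fun z h =>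
    nonneg_of_mul_nonneg_right (by rw [mul_neg, ← hsin]; linarith) (Real.exp_pos _)
  have cos_nonneg : ∀ z, 0 ≤ (Φ z).re → 0 ≤ Real.cos (L z).im := fun z h =>
    nonneg_of_mul_nonneg_right (hcos z ▸ h) (Real.exp_pos _)
  have cos_nonpos : ∀ z, (Φ z).re ≤ 0 → 0 ≤ -Real.cos (L z).im := fun z h =>
    nonneg_of_mul_nonneg_right (by rw [mul_neg, ← hcos]; linarith) (Real.exp_pos _)
  have el : ∀ t, (Φ (0, t)).re ≤ 0 := fun t => by
    rw [hre, Path.extend_zero]; linarith [hl (projIcc 0 1 zero_le_one t),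
      show (g.extend t).1 = (g (projIcc 0 1 zero_le_one t)).1 from rfl]
  have er : ∀ t, 0 ≤ (Φ (1, t)).re := fun t => by
    rw [hre, Path.extend_one]; linarith [hr (projIcc 0 1 zero_le_one t),
      show (g.extend t).1 = (g (projIcc 0 1 zero_le_one t)).1 from rfl]
  have eb : ∀ s, 0 ≤ (Φ (s, 0)).im := fun t => by
    rw [him, Path.extend_zero]; linarith [hb (projIcc 0 1 zero_le_one t),
      show (f.extend t).2 = (f (projIcc 0 1 zero_le_one t)).2 from rfl]
  have et : ∀ s, (Φ (s, 1)).im ≤ 0 := fun t => by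
    rw [him, Path.extend_one]; linarith [ht (projIcc 0 1 zero_le_one t),
      show (f.extend t).2 = (f (projIcc 0 1 zero_le_one t)).2 from rfl]
  set θ : ℝ × ℝ → ℝ := fun z => (L z).im with hθ
  have hθc : Continuous θ := by fun_prop
  have hpi := Real.pi_pos
  have s1 : ∀ x, Real.sin (x - Real.pi / 2) = -Real.cos x := Real.sin_sub_pi_div_two
  have s2 : ∀ x, Real.sin (x - Real.pi / 2 - Real.pi / 2) = -Real.sin x := fun x => by
    rw [Real.sin_sub_pi_div_two, Real.cos_sub_pi_div_two]
  have s3 : ∀ x, Real.sin (x - Real.pi / 2 - Real.pi / 2 - Real.pi / 2) = Real.cos x := fun x => by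
    rw [s2, s1, neg_neg]
  have s4 : ∀ x, Real.sin (x - Real.pi / 2 - Real.pi / 2 - Real.pi / 2 - Real.pi / 2) =
      Real.sin x := fun x => by rw [s2, s2, neg_neg]
  have h00 : θ (0, 0) ∈ Icc 0 Real.pi := by
    have : θ (0, 0) = Complex.arg (Φ (0, 0)) := by rw [hθ]; simp only [hL0, Complex.log_im]
    rw [this]
    exact ⟨Complex.arg_nonneg_iff.2 (eb 0), Complex.arg_le_pi _⟩
  -- Go around the parameter square through `(0, 1)`, `(1, 1)`, `(1, 0)` and back. The sign known on
  -- each side keeps the angle in a half-turn window, and each corner advances the window by `π /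
  -- 2`. On return the angle at `(0, 0)` is at least `2 * π`, although it started at most `π`.
  have c0 := sub_pi_div_two_mem_Icc h00 (by rw [s1]; exact cos_nonpos _ (el 0))
  have c1 := sub_pi_div_two_mem_Icc (mem_Icc_of_sin_nonneg
    (v := fun t => θ (0, t) - Real.pi / 2) (by fun_prop)
    (fun t => by rw [s1]; exact cos_nonpos _ (el t)) c0 1)
    (by rw [s2]; exact sin_nonpos _ (et 0))
  have c2 := sub_pi_div_two_mem_Icc (mem_Icc_of_sin_nonneg
    (v := fun s => θ (s, 1) - Real.pi / 2 - Real.pi / 2) (by fun_prop)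
    (fun t => by rw [s2]; exact sin_nonpos _ (et t)) c1 1)
    (by rw [s3]; exact cos_nonneg _ (er 1))
  have c3 := sub_pi_div_two_mem_Icc (mem_Icc_of_sin_nonneg
    (v := fun t => θ (1, 1 - t) - Real.pi / 2 - Real.pi / 2 - Real.pi / 2) (by fun_prop)
    (fun t => by rw [s3]; exact cos_nonneg _ (er _)) (by simpa using c2) 1)
    (by rw [s4]; exact sin_nonneg _ (by simpa using eb 1))
  have c4 := mem_Icc_of_sin_nonneg
    (v := fun s => θ (1 - s, 0) - Real.pi / 2 - Real.pi / 2 - Real.pi / 2 - Real.pi / 2)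
    (by fun_prop) (fun t => by rw [s4]; exact sin_nonneg _ (eb _)) (by simpa using c3) 1
  simp only [sub_self] at c4
  linarith [c4.1, h00.2]

/-! ### Homotheties and vertical crossings -/

lemma mem_rect {a b c d : ℝ} {z : ℝ × ℝ} :
    z ∈ rect a b c d ↔ (a ≤ z.1 ∧ z.1 ≤ b) ∧ c ≤ z.2 ∧ z.2 ≤ d := Iff.rfl

lemma mem_boundingSquare {z : ℝ × ℝ} :
    z ∈ boundingSquare ↔ (0 ≤ z.1 ∧ z.1 ≤ 1) ∧ 0 < z.2 ∧ z.2 < 1 := Iff.rfl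

/-- The homothety `p ↦ r • p + v`. -/
def homothety (r : ℝ) (v : ℝ × ℝ) (p : ℝ × ℝ) : ℝ × ℝ := r • p + v

@[simp] lemma homothety_fst (r : ℝ) (v p : ℝ × ℝ) : (homothety r v p).1 = r * p.1 + v.1 := rfl

@[simp] lemma homothety_snd (r : ℝ) (v p : ℝ × ℝ) : (homothety r v p).2 = r * p.2 + v.2 := rfl

lemma homothety_injective {r : ℝ} (hr : 0 < r) (v : ℝ × ℝ) :
    Function.Injective (homothety r v) := by
  intro p q h
  have h1 := congrArg Prod.fst h
  have h2 := congrArg Prod.snd h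
  simp only [homothety_fst, homothety_snd, add_left_inj] at h1 h2
  exact Prod.ext (mul_left_cancel₀ hr.ne' h1) (mul_left_cancel₀ hr.ne' h2)

lemma continuous_homothety (r : ℝ) (v : ℝ × ℝ) : Continuous (homothety r v) := by
  unfold homothety; fun_prop

lemma IsHomotheticCopy.image_homothety {X Y : Set (ℝ × ℝ)} (h : IsHomotheticCopy X Y) {r : ℝ}
    (hr : 0 < r) (v : ℝ × ℝ) : IsHomotheticCopy X (homothety r v '' Y) := by
  obtain ⟨s, w, hs, rfl⟩ := h
  refine ⟨r * s, r • w + v, mul_pos hr hs, ?_⟩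
  rw [image_image]
  refine image_congr fun p _ => ?_
  simp only [homothety, smul_add, mul_smul, add_assoc]

lemma isHomotheticCopy_homothety (X : Set (ℝ × ℝ)) {r : ℝ} (hr : 0 < r) (v : ℝ × ℝ) :
    IsHomotheticCopy X (homothety r v '' X) := ⟨r, v, hr, rfl⟩

lemma image_homothety_inter_nonempty {r : ℝ} (hr : 0 < r) (v : ℝ × ℝ) {A B : Set (ℝ × ℝ)} :
    (homothety r v '' A ∩ homothety r v '' B).Nonempty ↔ (A ∩ B).Nonempty := by
  rw [← image_inter (homothety_injective hr v), image_nonempty]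

/-- `Y` contains a curve to the right of the line `{x} × ℝ` that starts at height at most `b` and
ends at height at least `d`. -/
def Stabs (Y : Set (ℝ × ℝ)) (x b d : ℝ) : Prop :=
  ∃ p q : ℝ × ℝ, p.2 ≤ b ∧ d ≤ q.2 ∧ JoinedIn (Y ∩ {z | x ≤ z.1}) p q

lemma Stabs.mono {Y : Set (ℝ × ℝ)} {x b d x' b' d' : ℝ} (h : Stabs Y x b d) (hx : x' ≤ x)
    (hb : b ≤ b') (hd : d' ≤ d) : Stabs Y x' b' d' := by
  obtain ⟨p, q, hp, hq, hj⟩ := h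
  exact ⟨p, q, hp.trans hb, hd.trans hq,
    hj.mono (inter_subset_inter_right _ fun z (hz : x ≤ z.1) => hx.trans hz)⟩

lemma Stabs.image_homothety {Y : Set (ℝ × ℝ)} {x b d r : ℝ} (h : Stabs Y x b d) (hr : 0 < r)
    (v : ℝ × ℝ) :
    Stabs (homothety r v '' Y) (r * x + v.1) (r * b + v.2) (r * d + v.2) := by
  obtain ⟨p, q, hp, hq, hj⟩ := h
  refine ⟨homothety r v p, homothety r v q, ?_, ?_,
    (hj.map (continuous_homothety r v)).mono ?_⟩
  · simp only [homothety_snd]; gcongr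
  · simp only [homothety_snd]; gcongr
  · rintro _ ⟨z, ⟨hz, hz'⟩, rfl⟩
    refine ⟨mem_image_of_mem _ hz, ?_⟩
    simp only [mem_ofPred_eq, homothety_fst] at hz' ⊢
    gcongr

/-! ### Probes, configurations and forced colors -/

/-- A probe is a rectangle extending to the line `{1} × ℝ`, with a square root at its left end. -/
@[ext] structure Probe where
  left : ℝ
  bottom : ℝ
  height : ℝ

namespace Probe

/-- The square at the left end of a probe. -/
def root (P : Probe) : Set (ℝ × ℝ) :=
  rect P.left (P.left + P.height) P.bottom (P.bottom + P.height)

/-- The rectangle of a probe. -/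
def region (P : Probe) : Set (ℝ × ℝ) := rect P.left 1 P.bottom (P.bottom + P.height)

/-- `Y` crosses the probe vertically to the right of its root. -/
def Stabbed (P : Probe) (Y : Set (ℝ × ℝ)) : Prop :=
  Stabs Y (P.left + P.height) P.bottom (P.bottom + P.height)

/-- The homothety taking the unit square to the root of a probe. -/
def toRoot (P : Probe) : ℝ × ℝ → ℝ × ℝ := homothety P.height (P.left, P.bottom)

/-- The probe whose root is placed in the root of `P` as the root of `R` is in the unit square. -/
def nest (P R : Probe) : Probe :=
  ⟨P.height * R.left + P.left, P.height * R.bottom + P.bottom, P.height * R.height⟩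

end Probe

/-- A rectangle is a valid probe for the family `F`. -/
structure IsProbe (F : Set (Set (ℝ × ℝ))) (P : Probe) : Prop where
  height_pos : 0 < P.height
  left_nonneg : 0 ≤ P.left
  right_le : P.left + P.height ≤ 1
  bottom_pos : 0 < P.bottom
  top_lt : P.bottom + P.height < 1
  root_disjoint : ∀ Y ∈ F, ∀ z ∈ Y, z ∉ P.root
  stabbed : ∀ Y ∈ F, (Y ∩ P.region).Nonempty → P.Stabbed Y
  eq_of_inter : ∀ Y ∈ F, ∀ Z ∈ F, (Y ∩ P.region).Nonempty → (Z ∩ P.region).Nonempty →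
    (Y ∩ Z).Nonempty → Y = Z

/-- No three different members of `F` are pairwise intersecting. -/
def TriangleFree (F : Set (Set (ℝ × ℝ))) : Prop :=
  ∀ A ∈ F, ∀ B ∈ F, ∀ C ∈ F, A ≠ B → A ≠ C → B ≠ C →
    (A ∩ B).Nonempty → (A ∩ C).Nonempty → (B ∩ C).Nonempty → False

/-- Intersecting members of `F` receive different colors. -/
def IsProper (F : Set (Set (ℝ × ℝ))) (c : Set (ℝ × ℝ) → ℕ) : Prop :=
  ∀ A ∈ F, ∀ B ∈ F, A ≠ B → (A ∩ B).Nonempty → c A ≠ c B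

/-- A triangle-free family of homothetic copies of `X` in the unit square, with a finite set of
disjoint probes of relative extent at most `ε` to the right of the root. -/
structure IsConfiguration (X : Set (ℝ × ℝ)) (ε : ℝ) (F : Set (Set (ℝ × ℝ))) (𝓟 : Set Probe) :
    Prop where
  finite : F.Finite
  probes_finite : 𝓟.Finite
  copy : ∀ Y ∈ F, IsHomotheticCopy X Y
  subset_boundingSquare : ∀ Y ∈ F, Y ⊆ boundingSquare
  triangleFree : TriangleFree F
  isProbe : ∀ P ∈ 𝓟, IsProbe F P
  extent_le : ∀ P ∈ 𝓟, 1 - (P.left + P.height) ≤ ε * P.height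
  eq_of_mem : ∀ P ∈ 𝓟, ∀ Q ∈ 𝓟, ∀ y, P.bottom ≤ y → y ≤ P.bottom + P.height →
    Q.bottom ≤ y → y ≤ Q.bottom + Q.height → P = Q

/-- Every proper coloring uses at least `k` colors on the members crossing some probe. -/
def Forces (k : ℕ) (F : Set (Set (ℝ × ℝ))) (𝓟 : Set Probe) : Prop :=
  ∀ c, IsProper F c → ∃ P ∈ 𝓟, (k : ℕ∞) ≤ (c '' {Y ∈ F | P.Stabbed Y}).encard

/-- For every proper coloring and every set `B` of at least `k` colors, the members crossing some
probe use, together with `B`, at least `k + 1` colors. -/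
def ForcesBeyond (k : ℕ) (F : Set (Set (ℝ × ℝ))) (𝓟 : Set Probe) : Prop :=
  ∀ c, IsProper F c → ∀ B : Set ℕ, (k : ℕ∞) ≤ B.encard →
    ∃ P ∈ 𝓟, ((k + 1 : ℕ) : ℕ∞) ≤ (B ∪ c '' {Y ∈ F | P.Stabbed Y}).encard

lemma exists_height_lower_bound {𝓟 : Set Probe} (hfin : 𝓟.Finite)
    (hpos : ∀ P ∈ 𝓟, 0 < P.height) : ∃ q, 0 < q ∧ q ≤ 1 ∧ ∀ P ∈ 𝓟, q ≤ P.height := by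
  induction 𝓟, hfin using Set.Finite.induction_on with
  | empty => exact ⟨1, one_pos, le_rfl, by simp⟩
  | @insert P S _ _ ih =>
    obtain ⟨q, h0, h1, hq⟩ := ih fun P hP => hpos P (mem_insert_of_mem _ hP)
    refine ⟨min q P.height, lt_min h0 (hpos P (mem_insert _ _)), (min_le_left _ _).trans h1, ?_⟩
    rintro R (rfl | hR)
    · exact min_le_right _ _
    · exact (min_le_left _ _).trans (hq R hR)

lemma IsProper.comp_homothety {F G : Set (Set (ℝ × ℝ))} {c : Set (ℝ × ℝ) → ℕ} (hc : IsProper F c)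
    {r : ℝ} (hr : 0 < r) (v : ℝ × ℝ) (hG : ∀ Y ∈ G, homothety r v '' Y ∈ F) :
    IsProper G fun Y => c (homothety r v '' Y) := fun A hA B hB hAB hI =>
  hc _ (hG A hA) _ (hG B hB) ((image_injective.2 (homothety_injective hr v)).ne hAB)
    ((image_homothety_inter_nonempty hr v).2 hI)

lemma TriangleFree.image_homothety {G : Set (Set (ℝ × ℝ))} (hG : TriangleFree G) {r : ℝ}
    (hr : 0 < r) (v : ℝ × ℝ) {A B C : Set (ℝ × ℝ)} (hA : A ∈ G) (hB : B ∈ G) (hC : C ∈ G)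
    (hAB : homothety r v '' A ≠ homothety r v '' B) (hAC : homothety r v '' A ≠ homothety r v '' C)
    (hBC : homothety r v '' B ≠ homothety r v '' C)
    (h1 : (homothety r v '' A ∩ homothety r v '' B).Nonempty)
    (h2 : (homothety r v '' A ∩ homothety r v '' C).Nonempty)
    (h3 : (homothety r v '' B ∩ homothety r v '' C).Nonempty) : False := by
  rw [image_homothety_inter_nonempty hr] at h1 h2 h3
  exact hG A hA B hB C hC (fun h => hAB (h ▸ rfl)) (fun h => hAC (h ▸ rfl))
    (fun h => hBC (h ▸ rfl)) h1 h2 h3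

/-! ### Nesting one configuration in the roots of another -/

/-- Placing a copy of `G` in the root of every probe of `F`. -/
def nestFamily (F : Set (Set (ℝ × ℝ))) (𝓟 : Set Probe) (G : Set (Set (ℝ × ℝ))) :
    Set (Set (ℝ × ℝ)) := F ∪ image2 (fun P Y => P.toRoot '' Y) 𝓟 G

lemma Probe.toRoot_image_subset {P : Probe} (hP : 0 < P.height) {Y : Set (ℝ × ℝ)}
    (hY : Y ⊆ boundingSquare) : P.toRoot '' Y ⊆ P.root := by
  rintro _ ⟨z, hz, rfl⟩
  obtain ⟨⟨h1, h2⟩, h3, h4⟩ := mem_boundingSquare.1 (hY hz)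
  simp only [Probe.root, Probe.toRoot, mem_rect, homothety_fst, homothety_snd]
  refine ⟨⟨?_, ?_⟩, ?_, ?_⟩ <;> nlinarith

lemma Probe.nest_region_subset {F G : Set (Set (ℝ × ℝ))} {P R : Probe} (hP : IsProbe F P)
    (hR : IsProbe G R) : (P.nest R).region ⊆ P.region := by
  rintro z ⟨⟨h1, h2⟩, h3, h4⟩
  have a1 := mul_nonneg hP.height_pos.le hR.left_nonneg
  have a2 := mul_nonneg hP.height_pos.le hR.bottom_pos.le
  have a3 := mul_le_mul_of_nonneg_left hR.top_lt.le hP.height_pos.le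
  simp only [Probe.nest] at h1 h2 h3 h4
  refine ⟨⟨?_, h2⟩, ?_, ?_⟩ <;> linarith

/-- The nested probe lies inside `P`, so the members of `F` it meets cross `P` and hence it too.
Copies of `G` in other roots have other heights, and the copy in the root of `P` is disjoint from
all of `F`. -/
lemma isProbe_nest {X : Set (ℝ × ℝ)} {ε' ε₀ : ℝ} {F G : Set (Set (ℝ × ℝ))} {𝓟 ℛ : Set Probe}
    (hF : IsConfiguration X ε' F 𝓟) (hG : IsConfiguration X ε₀ G ℛ) {P R : Probe} (hP : P ∈ 𝓟)
    (hR : R ∈ ℛ) : IsProbe (nestFamily F 𝓟 G) (P.nest R) := by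
  have hPp := hF.isProbe P hP
  have hRp := hG.isProbe R hR
  have hh := hPp.height_pos
  have hsub := Probe.nest_region_subset hPp hRp
  have a1 := mul_nonneg hh.le hRp.left_nonneg
  have a2 := mul_pos hh hRp.bottom_pos
  have a3 := mul_le_mul_of_nonneg_left hRp.top_lt.le hh.le
  have a4 := mul_le_mul_of_nonneg_left hRp.right_le hh.le
  have hl := hPp.left_nonneg
  have hr := hPp.right_le
  have hb := hPp.bottom_pos
  have ht := hPp.top_lt
  have hroot : (P.nest R).root ⊆ P.root := by
    rintro z ⟨⟨h1, h2⟩, h3, h4⟩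
    simp only [Probe.nest] at h1 h2 h3 h4
    refine ⟨⟨?_, ?_⟩, ?_, ?_⟩ <;> linarith
  have hrr : (P.nest R).root ⊆ (P.nest R).region := by
    rintro z ⟨⟨h1, h2⟩, h3, h4⟩
    refine ⟨⟨h1, ?_⟩, h3, h4⟩
    simp only [Probe.nest] at h2
    linarith
  have same : ∀ P' ∈ 𝓟, ∀ Y ∈ G, ∀ z ∈ P'.toRoot '' Y, z ∈ (P.nest R).region → P' = P := by
    intro P' hP' Y hY z hz hz'
    have h1 := Probe.toRoot_image_subset (hF.isProbe P' hP').height_pos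
      (hG.subset_boundingSquare Y hY) hz
    have h2 := hsub hz'
    exact hF.eq_of_mem P' hP' P hP z.2 h1.2.1 h1.2.2 h2.2.1 h2.2.2
  -- The nested region runs past the root of `P` up to `1`, but the copy of `G` stays in the root,
  -- so nothing of it is met beyond the image of `R.region`.
  have inner : ∀ Y ∈ G, ∀ z ∈ Y, P.toRoot z ∈ (P.nest R).region → z ∈ R.region := by
    rintro Y hY z hz ⟨⟨h1, h2⟩, h3, h4⟩
    simp only [Probe.nest, Probe.toRoot, homothety_fst, homothety_snd, add_le_add_iff_right]
      at h1 h2 h3 h4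
    refine ⟨⟨le_of_mul_le_mul_left h1 hh, (hG.subset_boundingSquare Y hY hz).1.2⟩,
      le_of_mul_le_mul_left h3 hh, le_of_mul_le_mul_left ?_ hh⟩
    linarith
  have inner' : ∀ Y ∈ G, (P.toRoot '' Y ∩ (P.nest R).region).Nonempty →
      (Y ∩ R.region).Nonempty := by
    rintro Y hY ⟨_, ⟨z, hz, rfl⟩, hz'⟩
    exact ⟨z, hz, inner Y hY z hz hz'⟩
  have outer : ∀ A ∈ F, ∀ Y ∈ G, ¬(A ∩ P.toRoot '' Y).Nonempty := by
    rintro A hA Y hY ⟨z, hz, hz'⟩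
    exact hPp.root_disjoint A hA z hz
      (Probe.toRoot_image_subset hh (hG.subset_boundingSquare Y hY) hz')
  refine ⟨mul_pos hh hRp.height_pos, ?_, ?_, ?_, ?_, ?_, ?_, ?_⟩
  · simp only [Probe.nest]; linarith
  · simp only [Probe.nest]; linarith
  · simp only [Probe.nest]; linarith
  · simp only [Probe.nest]; linarith
  · rintro A (hA | ⟨P', hP', Y, hY, rfl⟩) z hz hz'
    · exact hPp.root_disjoint A hA z hz (hroot hz')
    · obtain rfl := same P' hP' Y hY z hz (hrr hz')
      obtain ⟨w, hw, rfl⟩ := hz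
      have h := inner Y hY w hw (hrr hz')
      refine hRp.root_disjoint Y hY w hw ⟨⟨h.1.1, ?_⟩, h.2⟩
      have := hz'.1.2
      simp only [Probe.nest, Probe.toRoot, homothety_fst] at this
      refine le_of_mul_le_mul_left ?_ hh
      linarith
  · rintro A (hA | ⟨P', hP', Y, hY, rfl⟩) hne
    · refine (hPp.stabbed A hA (hne.mono (inter_subset_inter_right _ hsub))).mono ?_ ?_ ?_ <;>
      simp only [Probe.nest] <;> linarith
    · obtain ⟨z, hz, hz'⟩ := hne
      obtain rfl := same P' hP' Y hY z hz hz'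
      refine ((hRp.stabbed Y hY (inner' Y hY ⟨z, hz, hz'⟩)).image_homothety hh
        (P'.left, P'.bottom)).mono (le_of_eq ?_) (le_of_eq ?_) (le_of_eq ?_) <;>
      simp only [Probe.nest] <;> ring
  · rintro A (hA | ⟨P', hP', Y, hY, rfl⟩) B (hB | ⟨P'', hP'', Z, hZ, rfl⟩) h1 h2 h3
    · exact hPp.eq_of_inter A hA B hB (h1.mono (inter_subset_inter_right _ hsub))
        (h2.mono (inter_subset_inter_right _ hsub)) h3
    · obtain rfl := same _ hP'' Z hZ _ h2.some_mem.1 h2.some_mem.2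
      exact (outer A hA Z hZ h3).elim
    · obtain rfl := same _ hP' Y hY _ h1.some_mem.1 h1.some_mem.2
      exact (outer B hB Y hY (inter_comm _ _ ▸ h3)).elim
    · obtain rfl := same _ hP' Y hY _ h1.some_mem.1 h1.some_mem.2
      obtain rfl := same _ hP'' Z hZ _ h2.some_mem.1 h2.some_mem.2
      rw [hRp.eq_of_inter Y hY Z hZ (inner' Y hY h1) (inner' Z hZ h2)
        ((image_homothety_inter_nonempty hh _).1 h3)]

/-- In `hε`, the gap to the right of a nested root is the gap of `P` plus that of `R` scaled by
`P.height`; the common factor `P.height` is cancelled. -/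
theorem isConfiguration_nest {X : Set (ℝ × ℝ)} {ε ε' ε₀ : ℝ} {F G : Set (Set (ℝ × ℝ))}
    {𝓟 ℛ : Set Probe} (hF : IsConfiguration X ε' F 𝓟) (hG : IsConfiguration X ε₀ G ℛ)
    (hε : ∀ R ∈ ℛ, ε' + ε₀ * R.height ≤ ε * R.height) :
    IsConfiguration X ε (nestFamily F 𝓟 G) (image2 Probe.nest 𝓟 ℛ) := by
  have hin : ∀ P ∈ 𝓟, ∀ Y ∈ G, P.toRoot '' Y ⊆ P.root := fun P hP Y hY =>
    Probe.toRoot_image_subset (hF.isProbe P hP).height_pos (hG.subset_boundingSquare Y hY)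
  have outer : ∀ A ∈ F, ∀ P ∈ 𝓟, ∀ Y ∈ G, ¬(A ∩ P.toRoot '' Y).Nonempty := by
    rintro A hA P hP Y hY ⟨z, hz, hz'⟩
    exact (hF.isProbe P hP).root_disjoint A hA z hz (hin P hP Y hY hz')
  have same : ∀ P ∈ 𝓟, ∀ Q ∈ 𝓟, ∀ Y ∈ G, ∀ Z ∈ G, (P.toRoot '' Y ∩ Q.toRoot '' Z).Nonempty →
      Q = P := by
    rintro P hP Q hQ Y hY Z hZ ⟨z, hz, hz'⟩
    have h1 := hin P hP Y hY hz
    have h2 := hin Q hQ Z hZ hz'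
    exact hF.eq_of_mem Q hQ P hP z.2 h2.2.1 h2.2.2 h1.2.1 h1.2.2
  constructor
  · exact hF.finite.union (hF.probes_finite.image2 _ hG.finite)
  · exact hF.probes_finite.image2 _ hG.probes_finite
  · rintro A (hA | ⟨P, hP, Y, hY, rfl⟩)
    · exact hF.copy A hA
    · exact (hG.copy Y hY).image_homothety (hF.isProbe P hP).height_pos _
  · rintro A (hA | ⟨P, hP, Y, hY, rfl⟩)
    · exact hF.subset_boundingSquare A hA
    · have h := hF.isProbe P hP
      intro z hz
      obtain ⟨⟨h1, h2⟩, h3, h4⟩ := hin P hP Y hY hz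
      exact ⟨⟨h.left_nonneg.trans h1, h2.trans h.right_le⟩, h.bottom_pos.trans_le h3,
        h4.trans_lt h.top_lt⟩
  · rintro A (hA | ⟨P, hP, Y, hY, rfl⟩) B hB C hC hAB hAC hBC h1 h2 h3
    · obtain hB | ⟨Q, hQ, Z, hZ, rfl⟩ := hB
      · obtain hC | ⟨R, hR, W, hW, rfl⟩ := hC
        · exact hF.triangleFree A hA B hB C hC hAB hAC hBC h1 h2 h3
        · exact outer A hA R hR W hW h2
      · exact outer A hA Q hQ Z hZ h1
    · obtain hB | ⟨Q, hQ, Z, hZ, rfl⟩ := hB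
      · exact outer B hB P hP Y hY (inter_comm _ _ ▸ h1)
      obtain hC | ⟨R, hR, W, hW, rfl⟩ := hC
      · exact outer C hC P hP Y hY (inter_comm _ _ ▸ h2)
      obtain rfl := same P hP Q hQ Y hY Z hZ h1
      obtain rfl := same Q hP R hR Y hY W hW h2
      exact hG.triangleFree.image_homothety (hF.isProbe R hP).height_pos _ hY hZ hW hAB hAC hBC
        h1 h2 h3
  · rintro _ ⟨P, hP, R, hR, rfl⟩
    exact isProbe_nest hF hG hP hR
  · rintro _ ⟨P, hP, R, hR, rfl⟩
    have h1 := hF.extent_le P hP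
    have hh := (hF.isProbe P hP).height_pos
    have h2 := mul_le_mul_of_nonneg_left (hG.extent_le R hR) hh.le
    have h3 := mul_le_mul_of_nonneg_left (hε R hR) hh.le
    simp only [Probe.nest]
    linarith
  · rintro _ ⟨P, hP, R, hR, rfl⟩ _ ⟨P', hP', R', hR', rfl⟩ y h1 h2 h3 h4
    have key : ∀ P ∈ 𝓟, ∀ R ∈ ℛ, P.height * R.bottom + P.bottom ≤ y →
        y ≤ P.height * R.bottom + P.bottom + P.height * R.height →
        P.bottom ≤ y ∧ y ≤ P.bottom + P.height := by
      intro P hP R hR h1 h2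
      have hh := (hF.isProbe P hP).height_pos
      have a2 := mul_pos hh (hG.isProbe R hR).bottom_pos
      have a3 := mul_le_mul_of_nonneg_left (hG.isProbe R hR).top_lt.le hh.le
      constructor <;> linarith
    simp only [Probe.nest] at h1 h2 h3 h4
    obtain ⟨k1, k2⟩ := key P hP R hR h1 h2
    obtain ⟨k3, k4⟩ := key P' hP' R' hR' h3 h4
    obtain rfl := hF.eq_of_mem P hP P' hP' y k1 k2 k3 k4
    have hh := (hF.isProbe P hP).height_pos
    rw [hG.eq_of_mem R hR R' hR' ((y - P.bottom) / P.height)]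
    · rw [le_div_iff₀ hh]; linarith
    · rw [div_le_iff₀ hh]; linarith
    · rw [le_div_iff₀ hh]; linarith
    · rw [div_le_iff₀ hh]; linarith

/-- The set `B` depends on the coloring, which is why every root receives a copy of `G` and why
`ForcesBeyond` quantifies over all `B`. Here `B` is the set of colors of the members of `F` crossing
`P`; they cross every probe nested in `P`. -/
theorem forces_nest {X : Set (ℝ × ℝ)} {ε' ε₀ : ℝ} {F G : Set (Set (ℝ × ℝ))}
    {𝓟 ℛ : Set Probe} {k : ℕ} (hF : IsConfiguration X ε' F 𝓟) (hG : IsConfiguration X ε₀ G ℛ)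
    (hkF : Forces k F 𝓟) (hkG : ForcesBeyond k G ℛ) :
    Forces (k + 1) (nestFamily F 𝓟 G) (image2 Probe.nest 𝓟 ℛ) := by
  intro c hc
  obtain ⟨P, hP, hk⟩ := hkF c fun A hA B hB => hc A (Or.inl hA) B (Or.inl hB)
  have hh := (hF.isProbe P hP).height_pos
  obtain ⟨R, hR, hk'⟩ := hkG _ (hc.comp_homothety hh (P.left, P.bottom) (G := G)
    fun Y hY => Or.inr ⟨P, hP, Y, hY, rfl⟩) _ hk
  refine ⟨P.nest R, ⟨P, hP, R, hR, rfl⟩, hk'.trans (encard_le_encard ?_)⟩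
  have hRp := hG.isProbe R hR
  have a2 := mul_pos hh hRp.bottom_pos
  have a3 := mul_le_mul_of_nonneg_left hRp.top_lt.le hh.le
  have a4 := mul_le_mul_of_nonneg_left hRp.right_le hh.le
  rintro _ (⟨A, ⟨hA, hs⟩, rfl⟩ | ⟨Y, ⟨hY, hs⟩, rfl⟩)
  · refine mem_image_of_mem c ⟨Or.inl hA, hs.mono ?_ ?_ ?_⟩ <;> simp only [Probe.nest] <;> linarith
  · refine mem_image_of_mem c ⟨Or.inr ⟨P, hP, Y, hY, rfl⟩, (hs.image_homothety hh
        (P.left, P.bottom)).mono (le_of_eq ?_) (le_of_eq ?_) (le_of_eq ?_)⟩ <;>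
      simp only [Probe.nest] <;> ring

/-! ### Diagonals and the splitting of probes -/

/-- An `ε`-empty square `[x, x + ξ] × [y, y + ξ]` of a normalized anchored set. -/
structure IsEmptySquare (X : Set (ℝ × ℝ)) (ε x y ξ : ℝ) : Prop where
  pos : 0 < ξ
  subset : rect x (x + ξ) y (y + ξ) ⊆ boundingSquare
  disjoint : Disjoint (rect x (x + ξ) y (y + ξ)) X
  small : (1 + ε) * ξ < ε
  gap : 1 - (x + ξ) = ε * ξ
  left_stabber : ContainsHorizontalStabber X 0 x 0 1
  right_stabber : ContainsVerticalStabber X (x + ξ) 1 y (y + ξ)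

/-- The homothety taking the unit square to the square of side `s` whose right side lies on the
line `{1} × ℝ` and that occupies the upper half of the probe `Q`, when `Q` has height `2 * s`. -/
noncomputable def Probe.diagonalMap (Q : Probe) : ℝ × ℝ → ℝ × ℝ :=
  homothety (Q.height / 2) (1 - Q.height / 2, Q.bottom + Q.height / 2)

/-- The lower half of a probe. -/
noncomputable def Probe.lower (Q : Probe) : Probe := ⟨Q.left + Q.height / 2, Q.bottom, Q.height / 2⟩

/-- The probe whose root is the empty square of the diagonal of `Q`. -/
noncomputable def Probe.upper (Q : Probe) (x y ξ : ℝ) : Probe :=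
  ⟨Q.height / 2 * x + (1 - Q.height / 2), Q.height / 2 * y + (Q.bottom + Q.height / 2),
    Q.height / 2 * ξ⟩

/-- The family `F` with a diagonal added to each probe. -/
noncomputable def withDiagonals (X : Set (ℝ × ℝ)) (F : Set (Set (ℝ × ℝ))) (𝓟 : Set Probe) :
    Set (Set (ℝ × ℝ)) := F ∪ (fun Q : Probe => Q.diagonalMap '' X) '' 𝓟

/-- The lower and upper probes obtained from the probes in `𝓟`. -/
noncomputable def splitProbes (𝓟 : Set Probe) (x y ξ : ℝ) : Set Probe :=
  Probe.lower '' 𝓟 ∪ (fun Q : Probe => Q.upper x y ξ) '' 𝓟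

/-- A configuration that stays at distance `δ` to the left of the line `{1} × ℝ`, with room for the
diagonals. -/
structure IsSpaced (X : Set (ℝ × ℝ)) (ε δ x y ξ : ℝ) (F : Set (Set (ℝ × ℝ))) (𝓟 : Set Probe) :
    Prop extends IsConfiguration X (ε / 2) F 𝓟 where
  normalized : IsAnchoredNormalized X
  emptySquare : IsEmptySquare X δ x y ξ
  fst_le : ∀ Y ∈ F, ∀ z ∈ Y, z.1 ≤ 1 - δ
  le_one : ε ≤ 1
  delta_pos : 0 < δ
  delta_le : δ ≤ ε

namespace IsSpaced

variable {X : Set (ℝ × ℝ)} {ε δ x y ξ : ℝ} {F : Set (Set (ℝ × ℝ))} {𝓟 : Set Probe} {Q Q' : Probe}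

/-- The last bound is the important one: `1 - x = (1 + δ) * ξ < δ`, so the left stabber of a
diagonal ends inside the strip of width `δ` that `F` leaves free. -/
lemma bounds (h : IsSpaced X ε δ x y ξ F 𝓟) :
    0 ≤ x ∧ x + ξ < 1 ∧ 0 < y ∧ y + ξ < 1 ∧ 1 - x < δ := by
  have hE := h.emptySquare
  have hp := hE.pos
  have h1 := hE.subset (show ((x, y) : ℝ × ℝ) ∈ _ from
    ⟨⟨le_rfl, by dsimp; linarith⟩, le_rfl, by dsimp; linarith⟩)
  have h2 := hE.subset (show ((x + ξ, y + ξ) : ℝ × ℝ) ∈ _ from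
    ⟨⟨by dsimp; linarith, le_rfl⟩, by dsimp; linarith, le_rfl⟩)
  have h3 := mul_pos h.delta_pos hp
  exact ⟨h1.1.1, by linarith [hE.gap], h1.2.1, h2.2.2, by linarith [hE.gap, hE.small]⟩

lemma diagonal_subset (h : IsSpaced X ε δ x y ξ F 𝓟) (hQ : Q ∈ 𝓟) {z : ℝ × ℝ}
    (hz : z ∈ Q.diagonalMap '' X) : (1 - Q.height / 2 ≤ z.1 ∧ z.1 ≤ 1) ∧
      Q.bottom + Q.height / 2 < z.2 ∧ z.2 < Q.bottom + Q.height := by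
  obtain ⟨w, hw, rfl⟩ := hz
  obtain ⟨⟨h1, h2⟩, h3, h4⟩ := h.normalized.subset_boundingSquare hw
  have hh := (h.isProbe Q hQ).height_pos
  simp only [Probe.diagonalMap, homothety_fst, homothety_snd]
  refine ⟨⟨?_, ?_⟩, ?_, ?_⟩ <;> nlinarith

lemma diagonal_subset_region (h : IsSpaced X ε δ x y ξ F 𝓟) (hQ : Q ∈ 𝓟) :
    Q.diagonalMap '' X ⊆ Q.region := by
  intro z hz
  obtain ⟨⟨h1, h2⟩, h3, h4⟩ := h.diagonal_subset hQ hz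
  have hp := h.isProbe Q hQ
  have := hp.height_pos
  have := hp.right_le
  exact ⟨⟨by linarith, h2⟩, by linarith, h4.le⟩

lemma diagonal_disjoint (h : IsSpaced X ε δ x y ξ F 𝓟) (hQ : Q ∈ 𝓟) (hQ' : Q' ∈ 𝓟)
    {z : ℝ × ℝ} (hz : z ∈ Q.diagonalMap '' X) (hz' : z ∈ Q'.region) : Q = Q' := by
  have h1 := h.diagonal_subset_region hQ hz
  exact h.eq_of_mem Q hQ Q' hQ' z.2 h1.2.1 h1.2.2 hz'.2.1 hz'.2.2

/-- The right stabber of the diagonal lies in the free strip, which no member of `F` enters. -/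
lemma diagonal_ne (h : IsSpaced X ε δ x y ξ F 𝓟) (hQ : Q ∈ 𝓟) : Q.diagonalMap '' X ∉ F := by
  intro hF
  obtain ⟨p, _, _, _, hj⟩ := h.emptySquare.right_stabber
  obtain ⟨hp, hp'⟩ := hj.source_mem
  have h1 := h.fst_le _ hF _ (mem_image_of_mem _ hp)
  have h2 := hp'.1.1
  have hP := h.isProbe Q hQ
  have hh := hP.height_pos
  have hh' := hP.top_lt
  have hb := hP.bottom_pos
  have hx := h.bounds.2.2.2.2
  have hξ := h.emptySquare.pos
  simp only [Probe.diagonalMap, homothety_fst] at h1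
  nlinarith [mul_le_mul_of_nonneg_left h2 hh.le, mul_lt_mul_of_pos_left hx hh, h.delta_pos]

/-- The left stabber of the diagonal starts at abscissa `1 - Q.height / 2`, not to the right of the
end of the root since the extent is small, and ends to the right of `1 - δ`. A crossing curve of `Y`
lies between these abscissas and spans all heights of `Q`, so the two curves meet. -/
lemma diagonal_stabs (h : IsSpaced X ε δ x y ξ F 𝓟) (hQ : Q ∈ 𝓟) {Y : Set (ℝ × ℝ)} (hY : Y ∈ F)
    (hs : Q.Stabbed Y) : (Q.diagonalMap '' X ∩ Y).Nonempty := by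
  obtain ⟨p', q', hp', hq', hg⟩ := hs
  obtain ⟨p, q, hp, hq, hf⟩ := h.emptySquare.left_stabber
  have hP := h.isProbe Q hQ
  have hh := hP.height_pos
  have hh' := hP.top_lt
  have hb := hP.bottom_pos
  have hx := h.bounds.2.2.2.2
  have hex := h.extent_le Q hQ
  have hle := h.le_one
  have hf' := (hf.mono inter_subset_left).map
    (show Continuous Q.diagonalMap from continuous_homothety _ _)
  suffices hm : ∃ s t, hf'.somePath s = hg.somePath t by
    obtain ⟨s, t, hst⟩ := hm
    exact ⟨_, hf'.somePath_mem s, hst ▸ (hg.somePath_mem t).1⟩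
  apply exists_path_eq_path
  · intro t
    have h1 : Q.left + Q.height ≤ (hg.somePath t).1 := (hg.somePath_mem t).2
    simp only [Probe.diagonalMap, homothety_fst, hp]
    nlinarith
  · intro t
    have h1 := h.fst_le Y hY _ (hg.somePath_mem t).1
    simp only [Probe.diagonalMap, homothety_fst, hq]
    nlinarith [mul_lt_mul_of_pos_left hx hh, h.delta_pos]
  · intro s
    have h1 := h.diagonal_subset hQ (hf'.somePath_mem s)
    linarith
  · intro s
    have h1 := h.diagonal_subset hQ (hf'.somePath_mem s)
    linarith

/-- Diagonals lie in disjoint probes, so the neighbors of a diagonal belong to `F`; they all meet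
`Q.region` and are therefore pairwise disjoint. -/
lemma no_triangle_diagonal (h : IsSpaced X ε δ x y ξ F 𝓟) (hQ : Q ∈ 𝓟) {A B : Set (ℝ × ℝ)}
    (hA : A ∈ withDiagonals X F 𝓟) (hB : B ∈ withDiagonals X F 𝓟) (hAB : A ≠ B)
    (hDA : A ≠ Q.diagonalMap '' X) (hDB : B ≠ Q.diagonalMap '' X)
    (h1 : (A ∩ B).Nonempty) (h2 : (Q.diagonalMap '' X ∩ A).Nonempty)
    (h3 : (Q.diagonalMap '' X ∩ B).Nonempty) : False := by
  have aux : ∀ A ∈ withDiagonals X F 𝓟, A ≠ Q.diagonalMap '' X →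
      (Q.diagonalMap '' X ∩ A).Nonempty → A ∈ F := by
    rintro A (hA | ⟨Q', hQ', rfl⟩) hne ⟨z, hz, hz'⟩
    · exact hA
    · rw [h.diagonal_disjoint hQ hQ' hz (h.diagonal_subset_region hQ' hz')] at hne
      exact (hne rfl).elim
  have aux' : ∀ A : Set (ℝ × ℝ), (Q.diagonalMap '' X ∩ A).Nonempty → (A ∩ Q.region).Nonempty :=
    fun A ⟨z, hz, hz'⟩ => ⟨z, hz', h.diagonal_subset_region hQ hz⟩
  exact hAB ((h.isProbe Q hQ).eq_of_inter A (aux A hA hDA h2) B (aux B hB hDB h3)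
    (aux' A h2) (aux' B h3) h1)

lemma triangleFree_withDiagonals (h : IsSpaced X ε δ x y ξ F 𝓟) :
    TriangleFree (withDiagonals X F 𝓟) := by
  intro A hA B hB C hC hAB hAC hBC h1 h2 h3
  by_cases hA' : A ∈ F
  · by_cases hB' : B ∈ F
    · by_cases hC' : C ∈ F
      · exact h.triangleFree A hA' B hB' C hC' hAB hAC hBC h1 h2 h3
      · obtain ⟨Q, hQ, rfl⟩ := hC.resolve_left hC'
        exact h.no_triangle_diagonal hQ hA hB hAB hAC hBC h1 (inter_comm _ _ ▸ h2)
          (inter_comm _ _ ▸ h3)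
    · obtain ⟨Q, hQ, rfl⟩ := hB.resolve_left hB'
      exact h.no_triangle_diagonal hQ hA hC hAC hAB hBC.symm h2 (inter_comm _ _ ▸ h1) h3
  · obtain ⟨Q, hQ, rfl⟩ := hA.resolve_left hA'
    exact h.no_triangle_diagonal hQ hB hC hBC hAB.symm hAC.symm h3 h1 h2

lemma isProbe_lower (h : IsSpaced X ε δ x y ξ F 𝓟) (hQ : Q ∈ 𝓟) :
    IsProbe (withDiagonals X F 𝓟) Q.lower := by
  have hP := h.isProbe Q hQ
  have hh := hP.height_pos
  have hl := hP.left_nonneg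
  have hr := hP.right_le
  have hb := hP.bottom_pos
  have ht := hP.top_lt
  have hsub : Q.lower.region ⊆ Q.region := by
    rintro z ⟨⟨h1, h2⟩, h3, h4⟩
    simp only [Probe.lower] at h1 h3 h4
    exact ⟨⟨by linarith, h2⟩, h3, by linarith⟩
  have hnot : ∀ A ∈ withDiagonals X F 𝓟, (A ∩ Q.lower.region).Nonempty → A ∈ F := by
    rintro A (hA | ⟨Q', hQ', rfl⟩) ⟨z, hz, hz'⟩
    · exact hA
    · obtain rfl := h.diagonal_disjoint hQ' hQ hz (hsub hz')
      have h1 := h.diagonal_subset hQ hz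
      have h2 := hz'.2.2
      simp only [Probe.lower] at h2
      linarith
  have hrr : Q.lower.root ⊆ Q.lower.region := by
    rintro z ⟨⟨h1, h2⟩, h3⟩
    simp only [Probe.lower] at h2
    exact ⟨⟨h1, by linarith⟩, h3⟩
  have hroot : Q.lower.root ⊆ Q.root := by
    rintro z ⟨⟨h1, h2⟩, h3, h4⟩
    simp only [Probe.lower] at h1 h2 h3 h4
    exact ⟨⟨by linarith, by linarith⟩, h3, by linarith⟩
  refine ⟨half_pos hh, ?_, ?_, hb, ?_, ?_, ?_, ?_⟩
  · simp only [Probe.lower]; linarith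
  · simp only [Probe.lower]; linarith
  · simp only [Probe.lower]; linarith
  · intro A hA z hz hz'
    exact hP.root_disjoint A (hnot A hA ⟨z, hz, hrr hz'⟩) z hz (hroot hz')
  · intro A hA hne
    refine (hP.stabbed A (hnot A hA hne) (hne.mono (inter_subset_inter_right _ hsub))).mono
      ?_ ?_ ?_ <;> simp only [Probe.lower] <;> linarith
  · intro A hA B hB h1 h2 h3
    exact hP.eq_of_inter A (hnot A hA h1) B (hnot B hB h2)
      (h1.mono (inter_subset_inter_right _ hsub)) (h2.mono (inter_subset_inter_right _ hsub)) h3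

lemma stabbed_upper (h : IsSpaced X ε δ x y ξ F 𝓟) (hQ : Q ∈ 𝓟) :
    (Q.upper x y ξ).Stabbed (Q.diagonalMap '' X) := by
  obtain ⟨p, q, hp, hq, hj⟩ := h.emptySquare.right_stabber
  have hs : Stabs X (x + ξ) y (y + ξ) := ⟨p, q, hp.le, hq.ge,
    hj.mono (inter_subset_inter_right _ fun z hz => hz.1.1)⟩
  refine (hs.image_homothety (half_pos (h.isProbe Q hQ).height_pos) _).mono (le_of_eq ?_)
    (le_of_eq ?_) (le_of_eq ?_) <;> simp only [Probe.upper] <;> ring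

/-- The upper probe lies in the free strip, so only the diagonal of `Q` can meet it. The root is the
empty square, and the right stabber supplies the crossing. -/
lemma isProbe_upper (h : IsSpaced X ε δ x y ξ F 𝓟) (hQ : Q ∈ 𝓟) :
    IsProbe (withDiagonals X F 𝓟) (Q.upper x y ξ) := by
  have hP := h.isProbe Q hQ
  have hh := hP.height_pos
  have hl := hP.left_nonneg
  have hr := hP.right_le
  have hb := hP.bottom_pos
  have ht := hP.top_lt
  obtain ⟨b1, b2, b3, b4, b5⟩ := h.bounds
  have hξ := h.emptySquare.pos
  have hδ := h.delta_pos
  have hlow : 1 - δ < Q.height / 2 * x + (1 - Q.height / 2) := by nlinarith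
  have hsub : (Q.upper x y ξ).region ⊆ Q.region := by
    rintro z ⟨⟨h1, h2⟩, h3, h4⟩
    simp only [Probe.upper] at h1 h3 h4
    refine ⟨⟨?_, h2⟩, ?_, ?_⟩ <;> nlinarith
  have honly : ∀ A ∈ withDiagonals X F 𝓟, (A ∩ (Q.upper x y ξ).region).Nonempty →
      A = Q.diagonalMap '' X := by
    rintro A (hA | ⟨Q', hQ', rfl⟩) ⟨z, hz, hz'⟩
    · have h1 := h.fst_le A hA z hz
      have h2 := hz'.1.1
      simp only [Probe.upper] at h2
      linarith
    · rw [h.diagonal_disjoint hQ' hQ hz (hsub hz')]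
  have hrr : (Q.upper x y ξ).root ⊆ (Q.upper x y ξ).region := by
    rintro z ⟨⟨h1, h2⟩, h3⟩
    simp only [Probe.upper] at h2
    exact ⟨⟨h1, by nlinarith⟩, h3⟩
  refine ⟨mul_pos (half_pos hh) hξ, ?_, ?_, ?_, ?_, ?_, ?_, ?_⟩
  · simp only [Probe.upper]; nlinarith
  · simp only [Probe.upper]; nlinarith
  · simp only [Probe.upper]; nlinarith
  · simp only [Probe.upper]; nlinarith
  · intro A hA z hz hz'
    obtain rfl := honly A hA ⟨z, hz, hrr hz'⟩
    obtain ⟨w, hw, rfl⟩ := hz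
    obtain ⟨⟨h1, h2⟩, h3, h4⟩ := hz'
    have hh2 := half_pos hh
    refine disjoint_left.1 h.emptySquare.disjoint (show w ∈ _ from ?_) hw
    simp only [Probe.upper, Probe.diagonalMap, homothety_fst, homothety_snd,
      add_le_add_iff_right] at h1 h2 h3 h4
    refine ⟨⟨le_of_mul_le_mul_left h1 hh2, le_of_mul_le_mul_left ?_ hh2⟩,
      le_of_mul_le_mul_left h3 hh2, le_of_mul_le_mul_left ?_ hh2⟩ <;> linarith
  · intro A hA hne
    rw [honly A hA hne]
    exact h.stabbed_upper hQ
  · intro A hA B hB h1 h2 h3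
    rw [honly A hA h1, honly B hB h2]

theorem isConfiguration_withDiagonals (h : IsSpaced X ε δ x y ξ F 𝓟) :
    IsConfiguration X ε (withDiagonals X F 𝓟) (splitProbes 𝓟 x y ξ) := by
  obtain ⟨b1, b2, b3, b4, b5⟩ := h.bounds
  have hξ := h.emptySquare.pos
  constructor
  · exact h.finite.union (h.probes_finite.image _)
  · exact (h.probes_finite.image _).union (h.probes_finite.image _)
  · rintro A (hA | ⟨Q, hQ, rfl⟩)
    · exact h.copy A hA
    · exact isHomotheticCopy_homothety X (half_pos (h.isProbe Q hQ).height_pos) _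
  · rintro A (hA | ⟨Q, hQ, rfl⟩)
    · exact h.subset_boundingSquare A hA
    · intro z hz
      obtain ⟨⟨h1, h2⟩, h3, h4⟩ := h.diagonal_subset_region hQ hz
      have hP := h.isProbe Q hQ
      exact ⟨⟨hP.left_nonneg.trans h1, h2⟩, hP.bottom_pos.trans_le h3, h4.trans_lt hP.top_lt⟩
  · exact h.triangleFree_withDiagonals
  · rintro _ (⟨Q, hQ, rfl⟩ | ⟨Q, hQ, rfl⟩)
    · exact h.isProbe_lower hQ
    · exact h.isProbe_upper hQ
  · rintro _ (⟨Q, hQ, rfl⟩ | ⟨Q, hQ, rfl⟩)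
    -- The lower probe keeps its gap while its height is halved, so `ε / 2` becomes `ε`.
    · have := h.extent_le Q hQ
      simp only [Probe.lower]
      linarith
    · have hh := half_pos (h.isProbe Q hQ).height_pos
      have hg := h.emptySquare.gap
      have h1 := mul_le_mul_of_nonneg_right h.delta_le (mul_pos hh hξ).le
      have h2 : Q.height / 2 * (1 - (x + ξ)) = δ * (Q.height / 2 * ξ) := by rw [hg]; ring
      simp only [Probe.upper]
      linarith
  · have hlow : ∀ Q ∈ 𝓟, ∀ t, Q.lower.bottom ≤ t → t ≤ Q.lower.bottom + Q.lower.height →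
        Q.bottom ≤ t ∧ t ≤ Q.bottom + Q.height / 2 := fun Q hQ t h1 h2 => ⟨h1, h2⟩
    have hupp : ∀ Q ∈ 𝓟, ∀ t, (Q.upper x y ξ).bottom ≤ t →
        t ≤ (Q.upper x y ξ).bottom + (Q.upper x y ξ).height →
        Q.bottom + Q.height / 2 < t ∧ t ≤ Q.bottom + Q.height := by
      intro Q hQ t h1 h2
      have hh := (h.isProbe Q hQ).height_pos
      simp only [Probe.upper] at h1 h2
      constructor <;> nlinarith
    rintro _ (⟨Q, hQ, rfl⟩ | ⟨Q, hQ, rfl⟩) _ (⟨R, hR, rfl⟩ | ⟨R, hR, rfl⟩) t h1 h2 h3 h4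
    · obtain ⟨k1, k2⟩ := hlow Q hQ t h1 h2
      obtain ⟨k3, k4⟩ := hlow R hR t h3 h4
      have := (h.isProbe Q hQ).height_pos
      have := (h.isProbe R hR).height_pos
      rw [h.eq_of_mem Q hQ R hR t k1 (by linarith) k3 (by linarith)]
    · obtain ⟨k1, k2⟩ := hlow Q hQ t h1 h2
      obtain ⟨k3, k4⟩ := hupp R hR t h3 h4
      have := (h.isProbe Q hQ).height_pos
      have := (h.isProbe R hR).height_pos
      obtain rfl := h.eq_of_mem Q hQ R hR t k1 (by linarith) (by linarith) k4
      linarith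
    · obtain ⟨k1, k2⟩ := hupp Q hQ t h1 h2
      obtain ⟨k3, k4⟩ := hlow R hR t h3 h4
      have := (h.isProbe Q hQ).height_pos
      have := (h.isProbe R hR).height_pos
      obtain rfl := h.eq_of_mem Q hQ R hR t (by linarith) k2 k3 (by linarith)
      linarith
    · obtain ⟨k1, k2⟩ := hupp Q hQ t h1 h2
      obtain ⟨k3, k4⟩ := hupp R hR t h3 h4
      have := (h.isProbe Q hQ).height_pos
      have := (h.isProbe R hR).height_pos
      rw [h.eq_of_mem Q hQ R hR t (by linarith) k2 (by linarith) k4]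

/-- The diagonal's color differs from those of the at least `k` colors crossing `Q`. If it is in
`B`, the lower probe adds these colors to it; if not, the upper probe adds it to `B`. -/
theorem forcesBeyond_withDiagonals (h : IsSpaced X ε δ x y ξ F 𝓟) {k : ℕ} (hk : Forces k F 𝓟) :
    ForcesBeyond k (withDiagonals X F 𝓟) (splitProbes 𝓟 x y ξ) := by
  intro c hc B hB
  obtain ⟨Q, hQ, hcard⟩ := hk c fun A hA A' hA' => hc A (Or.inl hA) A' (Or.inl hA')
  have hD : Q.diagonalMap '' X ∈ withDiagonals X F 𝓟 := Or.inr ⟨Q, hQ, rfl⟩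
  have hnot : c (Q.diagonalMap '' X) ∉ c '' {Y ∈ F | Q.Stabbed Y} := by
    rintro ⟨Y, ⟨hY, hs⟩, he⟩
    exact hc _ hD Y (Or.inl hY) (fun e => h.diagonal_ne hQ (e ▸ hY))
      (h.diagonal_stabs hQ hY hs) he.symm
  by_cases hcB : c (Q.diagonalMap '' X) ∈ B
  · refine ⟨Q.lower, Or.inl ⟨Q, hQ, rfl⟩, ?_⟩
    calc ((k + 1 : ℕ) : ℕ∞) = k + 1 := by push_cast; rfl
      _ ≤ (insert (c (Q.diagonalMap '' X)) (c '' {Y ∈ F | Q.Stabbed Y})).encard := by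
        rw [encard_insert_of_notMem hnot]; gcongr
      _ ≤ _ := encard_le_encard (insert_subset (Or.inl hcB) ?_)
    rintro _ ⟨Y, ⟨hY, hs⟩, rfl⟩
    have := (h.isProbe Q hQ).height_pos
    refine Or.inr (mem_image_of_mem c ⟨Or.inl hY, hs.mono ?_ ?_ ?_⟩) <;>
      simp only [Probe.lower] <;> linarith
  · refine ⟨Q.upper x y ξ, Or.inr ⟨Q, hQ, rfl⟩, ?_⟩
    calc ((k + 1 : ℕ) : ℕ∞) = k + 1 := by push_cast; rfl
      _ ≤ (insert (c (Q.diagonalMap '' X)) B).encard := by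
        rw [encard_insert_of_notMem hcB]; gcongr
      _ ≤ _ := encard_le_encard ?_
    exact insert_subset (Or.inr ⟨_, ⟨hD, h.stabbed_upper hQ⟩, rfl⟩) subset_union_left

end IsSpaced

/-! ### Contraction, to free a strip on the right -/

/-- The image of a probe under the contraction by `l` about the origin, extended to the right. -/
def Probe.scale (l : ℝ) (Q : Probe) : Probe := ⟨l * Q.left, l * Q.bottom, l * Q.height⟩

/-- The image of a family under the contraction by `l` about the origin. -/
def scaleFamily (l : ℝ) (F : Set (Set (ℝ × ℝ))) : Set (Set (ℝ × ℝ)) :=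
  (fun Y => homothety l 0 '' Y) '' F

/-- Probes still reach the line `{1} × ℝ`, so each gap grows by the strip width `1 - l`; `hε` pays
for this. -/
theorem isConfiguration_scale {X : Set (ℝ × ℝ)} {ε ε' l : ℝ} {F : Set (Set (ℝ × ℝ))}
    {𝓟 : Set Probe} (h : IsConfiguration X ε' F 𝓟) (hl : 0 < l) (hl1 : l ≤ 1)
    (hε : ∀ P ∈ 𝓟, 1 - l + ε' * (l * P.height) ≤ ε * (l * P.height)) :
    IsConfiguration X ε (scaleFamily l F) (Probe.scale l '' 𝓟) := by
  have bnd : ∀ Y ∈ F, ∀ z ∈ Y, (homothety l 0 z).1 ≤ l ∧ homothety l 0 z ∈ boundingSquare := by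
    intro Y hY z hz
    obtain ⟨⟨h1, h2⟩, h3, h4⟩ := h.subset_boundingSquare Y hY hz
    simp only [mem_boundingSquare, homothety_fst, homothety_snd, Prod.fst_zero, Prod.snd_zero]
    refine ⟨?_, ⟨?_, ?_⟩, ?_, ?_⟩ <;> nlinarith
  constructor
  · exact h.finite.image _
  · exact h.probes_finite.image _
  · rintro _ ⟨Y, hY, rfl⟩
    exact (h.copy Y hY).image_homothety hl 0
  · rintro _ ⟨Y, hY, rfl⟩ _ ⟨z, hz, rfl⟩
    exact (bnd Y hY z hz).2
  · rintro _ ⟨A, hA, rfl⟩ _ ⟨B, hB, rfl⟩ _ ⟨C, hC, rfl⟩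
    exact h.triangleFree.image_homothety hl 0 hA hB hC
  · rintro _ ⟨P, hP, rfl⟩
    have hp := h.isProbe P hP
    have reg : ∀ Y ∈ F, ∀ z ∈ Y, homothety l 0 z ∈ (P.scale l).region → z ∈ P.region := by
      rintro Y hY z hz ⟨⟨h1, h2⟩, h3, h4⟩
      simp only [Probe.scale, homothety_fst, homothety_snd, Prod.fst_zero, Prod.snd_zero, add_zero]
        at h1 h3 h4
      refine ⟨⟨le_of_mul_le_mul_left h1 hl, (h.subset_boundingSquare Y hY hz).1.2⟩,
        le_of_mul_le_mul_left h3 hl, le_of_mul_le_mul_left ?_ hl⟩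
      linarith
    have reg' : ∀ Y ∈ F, (homothety l 0 '' Y ∩ (P.scale l).region).Nonempty →
        (Y ∩ P.region).Nonempty := by
      rintro Y hY ⟨_, ⟨z, hz, rfl⟩, hz'⟩
      exact ⟨z, hz, reg Y hY z hz hz'⟩
    have a1 := mul_le_mul_of_nonneg_left hp.right_le hl.le
    have a2 := mul_lt_mul_of_pos_left hp.top_lt hl
    refine ⟨mul_pos hl hp.height_pos, mul_nonneg hl.le hp.left_nonneg, ?_,
      mul_pos hl hp.bottom_pos, ?_, ?_, ?_, ?_⟩
    · simp only [Probe.scale]; linarith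
    · simp only [Probe.scale]; linarith
    · rintro _ ⟨Y, hY, rfl⟩ _ ⟨z, hz, rfl⟩ ⟨⟨h1, h2⟩, h3, h4⟩
      simp only [Probe.scale, homothety_fst, homothety_snd, Prod.fst_zero, Prod.snd_zero, add_zero]
        at h1 h2 h3 h4
      refine hp.root_disjoint Y hY z hz ⟨⟨le_of_mul_le_mul_left h1 hl,
        le_of_mul_le_mul_left ?_ hl⟩, le_of_mul_le_mul_left h3 hl,
        le_of_mul_le_mul_left ?_ hl⟩ <;> linarith
    · rintro _ ⟨Y, hY, rfl⟩ hne
      refine ((hp.stabbed Y hY (reg' Y hY hne)).image_homothety hl 0).mono (le_of_eq ?_)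
        (le_of_eq ?_) (le_of_eq ?_) <;>
      simp only [Probe.scale, Prod.fst_zero, Prod.snd_zero] <;> ring
    · rintro _ ⟨Y, hY, rfl⟩ _ ⟨Z, hZ, rfl⟩ h1 h2 h3
      dsimp only at h1 h2 h3 ⊢
      rw [hp.eq_of_inter Y hY Z hZ (reg' Y hY h1) (reg' Z hZ h2)
        ((image_homothety_inter_nonempty hl 0).1 h3)]
  · rintro _ ⟨P, hP, rfl⟩
    have h1 := mul_le_mul_of_nonneg_left (h.extent_le P hP) hl.le
    have h2 := hε P hP
    simp only [Probe.scale]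
    linarith
  · rintro _ ⟨P, hP, rfl⟩ _ ⟨Q, hQ, rfl⟩ t h1 h2 h3 h4
    simp only [Probe.scale] at h1 h2 h3 h4
    rw [h.eq_of_mem P hP Q hQ (t / l)]
    · rw [le_div_iff₀ hl]; linarith
    · rw [div_le_iff₀ hl]; linarith
    · rw [le_div_iff₀ hl]; linarith
    · rw [div_le_iff₀ hl]; linarith

theorem forces_scale {l : ℝ} {F : Set (Set (ℝ × ℝ))} {𝓟 : Set Probe} {k : ℕ} (hl : 0 < l)
    (h : Forces k F 𝓟) : Forces k (scaleFamily l F) (Probe.scale l '' 𝓟) := by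
  intro c hc
  obtain ⟨P, hP, hk⟩ := h _ (hc.comp_homothety hl 0 fun Y hY => ⟨Y, hY, rfl⟩)
  refine ⟨_, ⟨P, hP, rfl⟩, hk.trans (encard_le_encard ?_)⟩
  rintro _ ⟨Y, ⟨hY, hs⟩, rfl⟩
  refine mem_image_of_mem c ⟨⟨Y, hY, rfl⟩, (hs.image_homothety hl 0).mono (le_of_eq ?_)
    (le_of_eq ?_) (le_of_eq ?_)⟩ <;> simp only [Probe.scale, Prod.fst_zero, Prod.snd_zero] <;> ring

/-! ### The induction on the number of colors -/

theorem exists_configuration_forcing {X : Set (ℝ × ℝ)} (hX : IsAnchoredNormalized X) (k : ℕ) :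
    ∀ ε : ℝ, 0 < ε → ε ≤ 1 → ∃ F 𝓟, IsConfiguration X ε F 𝓟 ∧ Forces k F 𝓟 := by
  induction k with
  | zero =>
    intro ε h0 h1
    refine ⟨∅, {⟨1 / 2, 1 / 4, 1 / 2⟩}, ⟨finite_empty, finite_singleton _, ?_, ?_, ?_, ?_, ?_, ?_⟩,
      fun c _ => ⟨_, rfl, by simp⟩⟩
    · simp
    · simp
    · rintro A ⟨⟩
    · rintro _ rfl
      constructor <;> simp <;> norm_num
    · rintro _ rfl
      norm_num [h0.le]
    · rintro _ rfl _ rfl _ _ _ _ _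
      rfl
  | succ k ih =>
    intro ε h0 h1
    -- The induction hypothesis is used twice, the second time with an `ε` depending on the gadget
    -- built from the first. Hence the claim is proved for all `ε` simultaneously.
    obtain ⟨F, 𝓟, hF, hkF⟩ := ih (ε / 8) (by linarith) (by linarith)
    obtain ⟨q, hq0, hq1, hq⟩ := exists_height_lower_bound hF.probes_finite
      fun P hP => (hF.isProbe P hP).height_pos
    -- The strip must be narrow relative to the lowest probe, so that contraction raises the extent
    -- from `ε / 8` to at most `ε / 4`.
    have hδ0 : 0 < ε * q / 32 := by positivity
    have hδε : ε * q / 32 ≤ ε / 32 := by nlinarith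
    generalize hδ : ε * q / 32 = δ at hδ0 hδε
    obtain ⟨x, y, ξ, e1, e2, e3, e4, e5, e6, e7⟩ := hX.exists_empty_square δ hδ0 (by linarith)
    have hl : 0 < 1 - δ := by linarith
    have hconf : IsConfiguration X (ε / 2 / 2) (scaleFamily (1 - δ) F)
        (Probe.scale (1 - δ) '' 𝓟) := by
      refine isConfiguration_scale hF hl (by linarith) fun P hP => ?_
      have hqP := hq P hP
      have hε : ε * q ≤ ε * P.height := mul_le_mul_of_nonneg_left hqP h0.le
      have : 0 < ε * P.height := by nlinarith
      nlinarith
    have hG : IsSpaced X (ε / 2) δ x y ξ (scaleFamily (1 - δ) F) (Probe.scale (1 - δ) '' 𝓟) := by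
      refine ⟨hconf, hX, ⟨e1, e2, e3, e4, e5, e6, e7⟩, ?_, by linarith, hδ0, by linarith⟩
      rintro _ ⟨Y, hY, rfl⟩ _ ⟨z, hz, rfl⟩
      have := (hF.subset_boundingSquare Y hY hz).1.2
      simp only [homothety_fst, Prod.fst_zero]
      nlinarith
    have hGc := hG.isConfiguration_withDiagonals
    have hGk := hG.forcesBeyond_withDiagonals (forces_scale hl hkF)
    obtain ⟨g, hg0, hg1, hg⟩ := exists_height_lower_bound hGc.probes_finite
      fun P hP => (hGc.isProbe P hP).height_pos
    -- The factor `g` makes the outer gap at most `ε / 2` times the height of any nested probe; the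
    -- gadget uses the other `ε / 2`.
    obtain ⟨F', 𝓟', hF', hkF'⟩ := ih (ε / 2 * g) (by positivity) (by nlinarith)
    refine ⟨_, _, isConfiguration_nest hF' hGc fun R hR => ?_, forces_nest hF' hGc hkF' hGk⟩
    nlinarith [hg R hR]

/-! ### Circles, squares and L-shapes are anchored -/

lemma exists_affineEquiv_frame (c w o : ℝ × ℝ) (hw : w ≠ 0) {s t : ℝ} (hs : s ≠ 0) (ht : t ≠ 0) :
    ∃ T : (ℝ × ℝ) ≃ᵃ[ℝ] (ℝ × ℝ),
      ∀ a b : ℝ, T (c + a • w + b • turn w) = (o.1 + s * a, o.2 + t * b) := by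
  have hn : w.1 ^ 2 + w.2 ^ 2 ≠ 0 := by
    intro h
    apply hw
    ext
    · simp only [Prod.fst_zero]; nlinarith [sq_nonneg w.1, sq_nonneg w.2]
    · simp only [Prod.snd_zero]; nlinarith [sq_nonneg w.1, sq_nonneg w.2]
  let e : (ℝ × ℝ) ≃ₗ[ℝ] (ℝ × ℝ) :=
    { toFun := fun p => (s * ((p.1 * w.1 + p.2 * w.2) / (w.1 ^ 2 + w.2 ^ 2)),
        t * ((p.2 * w.1 - p.1 * w.2) / (w.1 ^ 2 + w.2 ^ 2)))
      invFun := fun q => (q.1 / s * w.1 - q.2 / t * w.2, q.1 / s * w.2 + q.2 / t * w.1)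
      map_add' := fun p q => by ext <;> simp <;> ring
      map_smul' := fun r p => by ext <;> simp <;> ring
      left_inv := fun p => by ext <;> simp <;> field_simp <;> ring
      right_inv := fun q => by ext <;> simp <;> field_simp <;> ring }
  refine ⟨AffineEquiv.mk' (fun p => e (p - c) + o) e c fun p => by simp, fun a b => ?_⟩
  change e (c + a • w + b • turn w - c) + o = _
  ext
  · simp [e, turn]
    field_simp
    ring
  · simp [e, turn]
    field_simp
    ring

lemma joinedIn_of_continuousOn {f : ℝ → ℝ × ℝ} {a b : ℝ} (hab : a ≤ b)
    (hf : ContinuousOn f (Icc a b)) {S : Set (ℝ × ℝ)} (hS : ∀ u ∈ Icc a b, f u ∈ S) :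
    JoinedIn S (f a) (f b) := by
  have hmaps : MapsTo (fun u : ℝ => a + u * (b - a)) unitInterval (Icc a b) := by
    rintro u ⟨h0, h1⟩
    constructor <;> nlinarith
  refine JoinedIn.ofLine (f := fun u => f (a + u * (b - a)))
    (hf.comp (by fun_prop) hmaps) (by simp) (by simp) ?_
  rintro _ ⟨u, hu, rfl⟩
  exact hS _ (hmaps hu)

/-- Sets between the union of the bottom and right sides of a rectangle and its boundary. -/
lemma isAnchoredNormalized_of_sides {X : Set (ℝ × ℝ)}
    (hsub : X ⊆ rect 0 1 (1 / 4) (3 / 4))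
    (hint : ∀ z ∈ X, z.1 ≤ 0 ∨ 1 ≤ z.1 ∨ z.2 ≤ 1 / 4 ∨ 3 / 4 ≤ z.2)
    (hbot : ∀ u ∈ Icc (0 : ℝ) 1, (u, 1 / 4) ∈ X)
    (hright : ∀ u ∈ Icc (1 / 4 : ℝ) (3 / 4), (1, u) ∈ X) : IsAnchoredNormalized X := by
  refine ⟨fun z hz => ?_, fun ε h0 h1 => ?_⟩
  · obtain ⟨h1, h2, h3⟩ := hsub hz
    exact ⟨h1, by linarith, by linarith⟩
  have hsq : ε * (ε / 4) ≤ ε / 4 := by nlinarith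
  have hsq' : 0 < ε * (ε / 4) := by positivity
  -- With `ξ = ε / 4`, the gap condition determines `x`. The heights from `3 / 8` to less than `5 /
  -- 8` stay off the horizontal sides.
  refine ⟨1 - (1 + ε) * (ε / 4), 3 / 8, ε / 4, by linarith, ?_, ?_, by nlinarith, by ring,
    ⟨(0, 1 / 4), (1 - (1 + ε) * (ε / 4), 1 / 4), rfl, rfl, ?_⟩,
    ⟨(1, 3 / 8), (1, 3 / 8 + ε / 4), rfl, rfl, ?_⟩⟩
  · rintro z ⟨⟨h2, h3⟩, h4, h5⟩
    exact ⟨⟨by linarith, by linarith⟩, by linarith, by linarith⟩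
  · rw [disjoint_left]
    rintro z ⟨⟨h2, h3⟩, h4, h5⟩ hz
    rcases hint z hz with h | h | h | h <;> linarith
  · refine joinedIn_of_continuousOn (f := fun u => (u, 1 / 4)) (by linarith) (by fun_prop) ?_
    rintro u ⟨h2, h3⟩
    exact ⟨hbot u ⟨h2, by linarith⟩, ⟨h2, h3⟩, by norm_num, by norm_num⟩
  · refine joinedIn_of_continuousOn (f := fun u => (1, u)) (by linarith) (by fun_prop) ?_
    rintro u ⟨h2, h3⟩
    exact ⟨hright u ⟨by linarith, by linarith⟩, ⟨by dsimp; linarith, le_rfl⟩, h2, h3⟩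

theorem isAnchored_equilateralL {c w : ℝ × ℝ} (hw : w ≠ 0) : IsAnchored (equilateralL c w) := by
  -- The negative factor `s` puts the corner at the bottom right; `t` keeps the heights inside `(0,
  -- 1)`.
  obtain ⟨T, hT⟩ := exists_affineEquiv_frame c w (1, 1 / 4) hw (s := -1) (t := 1 / 2)
    (by norm_num) (by norm_num)
  have hmem : ∀ z, z ∈ T '' equilateralL c w ↔ (∃ u ∈ Icc (0 : ℝ) 1, z = (1 - u, 1 / 4)) ∨
      ∃ u ∈ Icc (0 : ℝ) 1, z = (1, 1 / 4 + u / 2) := by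
    intro z
    have h1 : ∀ u : ℝ, T (c + u • (c + w - c)) = (1 - u, 1 / 4) := fun u => by
      have := hT u 0
      simp only [zero_smul, add_zero] at this
      rw [add_sub_cancel_left, this]
      ext <;> simp [sub_eq_add_neg]
    have h2 : ∀ u : ℝ, T (c + u • (c + turn w - c)) = (1, 1 / 4 + u / 2) := fun u => by
      have := hT 0 u
      simp only [zero_smul, add_zero] at this
      rw [add_sub_cancel_left, this]
      ext <;> simp; ring
    simp only [equilateralL, image_union, segment_eq_image', image_image, h1, h2, mem_union,
      mem_image, eq_comm]
  refine ⟨T, isAnchoredNormalized_of_sides (fun z hz => ?_) (fun z hz => ?_) (fun u hu => ?_)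
    fun u hu => ?_⟩
  · rcases (hmem z).1 hz with ⟨u, ⟨h1, h2⟩, rfl⟩ | ⟨u, ⟨h1, h2⟩, rfl⟩ <;>
    refine ⟨⟨?_, ?_⟩, ?_, ?_⟩ <;> dsimp <;> linarith
  · rcases (hmem z).1 hz with ⟨u, ⟨h1, h2⟩, rfl⟩ | ⟨u, ⟨h1, h2⟩, rfl⟩
    · exact Or.inr (Or.inr (Or.inl le_rfl))
    · exact Or.inr (Or.inl le_rfl)
  · exact (hmem _).2 (Or.inl ⟨1 - u, ⟨by linarith [hu.2], by linarith [hu.1]⟩, by simp⟩)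
  · exact (hmem _).2 (Or.inr ⟨2 * (u - 1 / 4), ⟨by linarith [hu.1], by linarith [hu.2]⟩, by
      ext <;> dsimp; ring⟩)

theorem isAnchored_squareBoundary {c w : ℝ × ℝ} (hw : w ≠ 0) :
    IsAnchored (squareBoundary c w) := by
  obtain ⟨T, hT⟩ := exists_affineEquiv_frame c w (1 / 2, 1 / 2) hw (s := 1 / 2) (t := 1 / 4)
    (by norm_num) (by norm_num)
  have hmem : ∀ z, z ∈ T '' squareBoundary c w ↔
      ∃ a b : ℝ, max |a| |b| = 1 ∧ z = (1 / 2 + 1 / 2 * a, 1 / 2 + 1 / 4 * b) := by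
    intro z
    constructor
    · rintro ⟨_, ⟨a, b, hab, rfl⟩, rfl⟩
      exact ⟨a, b, hab, hT a b⟩
    · rintro ⟨a, b, hab, rfl⟩
      exact ⟨_, ⟨a, b, hab, rfl⟩, hT a b⟩
  refine ⟨T, isAnchoredNormalized_of_sides (fun z hz => ?_) (fun z hz => ?_) (fun u hu => ?_)
    fun u hu => ?_⟩
  · obtain ⟨a, b, hab, rfl⟩ := (hmem z).1 hz
    have ha := abs_le.1 ((le_max_left _ _).trans hab.le)
    have hb := abs_le.1 ((le_max_right _ _).trans hab.le)
    refine ⟨⟨?_, ?_⟩, ?_, ?_⟩ <;> dsimp <;> linarith [ha.1, ha.2, hb.1, hb.2]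
  · obtain ⟨a, b, hab, rfl⟩ := (hmem z).1 hz
    dsimp only
    rcases max_choice |a| |b| with h | h <;> rw [h] at hab <;>
      rcases eq_or_eq_neg_of_abs_eq hab with rfl | rfl
    · right; left; norm_num
    · left; norm_num
    · right; right; right; norm_num
    · right; right; left; norm_num
  · refine (hmem _).2 ⟨2 * u - 1, -1, ?_, ?_⟩
    · rw [abs_neg, abs_one]
      exact max_eq_right (abs_le.2 ⟨by linarith [hu.1], by linarith [hu.2]⟩)
    · ext <;> dsimp <;> ring
  · refine (hmem _).2 ⟨1, 4 * u - 2, ?_, ?_⟩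
    · rw [abs_one]
      exact max_eq_left (abs_le.2 ⟨by linarith [hu.1], by linarith [hu.2]⟩)
    · ext <;> dsimp <;> ring

/-- Near its rightmost point the ellipse leaves its vertical tangent only quadratically in the
height. A square of side `ε / 4` centered at height `1 / 2` with gap `ε ^ 2 / 4` therefore fits
inside, with the arc beside it entirely to its right. The lower arc is the left stabber. -/
lemma isAnchoredNormalized_ellipse :
    IsAnchoredNormalized {z : ℝ × ℝ | (2 * z.1 - 1) ^ 2 + (4 * z.2 - 2) ^ 2 = 1} := by
  refine ⟨fun z (hz : _ = _) => ⟨⟨?_, ?_⟩, ?_, ?_⟩, fun ε h0 h1 => ?_⟩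
  · nlinarith [sq_nonneg (4 * z.2 - 2)]
  · nlinarith [sq_nonneg (4 * z.2 - 2)]
  · nlinarith [sq_nonneg (2 * z.1 - 1)]
  · nlinarith [sq_nonneg (2 * z.1 - 1)]
  have hsq : ε * (ε / 4) ≤ ε / 4 := by nlinarith
  have hsq' : 0 < ε * (ε / 4) := by positivity
  -- In circle coordinates, `1 - 2 * (ε * (ε / 4))` and `ε / 2` are the coordinates of the upper
  -- right corner of the square.
  have hin : ∀ v : ℝ, 0 ≤ v → v ≤ 1 - 2 * (ε * (ε / 4)) → v ^ 2 + (ε / 2) ^ 2 < 1 := by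
    intro v hv hv'
    have : v ^ 2 ≤ (1 - 2 * (ε * (ε / 4))) ^ 2 := by gcongr
    nlinarith
  refine ⟨1 - (1 + ε) * (ε / 4), 1 / 2 - ε / 8, ε / 4, by linarith, ?_, ?_, by nlinarith, by ring,
    ?_, ?_⟩
  · rintro z ⟨⟨h2, h3⟩, h4, h5⟩
    exact ⟨⟨by linarith, by linarith⟩, by linarith, by linarith⟩
  · rw [disjoint_left]
    rintro z ⟨⟨h2, h3⟩, h4, h5⟩ (hz : _ = _)
    have := hin (2 * z.1 - 1) (by linarith) (by linarith)
    have : (4 * z.2 - 2) ^ 2 ≤ (ε / 2) ^ 2 := sq_le_sq' (by linarith) (by linarith)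
    linarith
  · let f : ℝ → ℝ × ℝ := fun u => (u, 1 / 2 - √(1 - (2 * u - 1) ^ 2) / 4)
    refine ⟨f 0, f (1 - (1 + ε) * (ε / 4)), rfl, rfl,
      joinedIn_of_continuousOn (by linarith) (by fun_prop) ?_⟩
    rintro u ⟨h2, h3⟩
    have hs := Real.sq_sqrt (show 0 ≤ 1 - (2 * u - 1) ^ 2 by nlinarith)
    have hs0 := Real.sqrt_nonneg (1 - (2 * u - 1) ^ 2)
    have hs1 : √(1 - (2 * u - 1) ^ 2) ≤ 1 := by
      exact Real.sqrt_le_one.2 (by nlinarith [sq_nonneg (2 * u - 1)])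
    refine ⟨?_, ⟨h2, h3⟩, ?_, ?_⟩
    · simp only [f, mem_ofPred_eq]; linear_combination hs
    · simp only [f]; linarith
    · simp only [f]; linarith
  · let f : ℝ → ℝ × ℝ := fun u => (1 / 2 + √(1 - (4 * u - 2) ^ 2) / 2, u)
    refine ⟨f (1 / 2 - ε / 8), f (1 / 2 - ε / 8 + ε / 4), rfl, rfl,
      joinedIn_of_continuousOn (by linarith) (by fun_prop) ?_⟩
    rintro u ⟨h2, h3⟩
    have hu : (4 * u - 2) ^ 2 ≤ (ε / 2) ^ 2 := sq_le_sq' (by linarith) (by linarith)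
    have hlow := hin (1 - 2 * (ε * (ε / 4))) (by linarith) le_rfl
    have hs := Real.sq_sqrt (show 0 ≤ 1 - (4 * u - 2) ^ 2 by nlinarith)
    have hs0 : 1 - 2 * (ε * (ε / 4)) ≤ √(1 - (4 * u - 2) ^ 2) :=
      Real.le_sqrt_of_sq_le (by linarith)
    have hs1 : √(1 - (4 * u - 2) ^ 2) ≤ 1 := by
      exact Real.sqrt_le_one.2 (by nlinarith [sq_nonneg (4 * u - 2)])
    refine ⟨?_, ⟨?_, ?_⟩, h2, h3⟩
    · simp only [f, mem_ofPred_eq]; linear_combination hs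
    · simp only [f]; linarith
    · simp only [f]; linarith

theorem isAnchored_circle {c : ℝ × ℝ} {r : ℝ} (hr : 0 < r) : IsAnchored (circle c r) := by
  obtain ⟨T, hT⟩ := exists_affineEquiv_frame c (r, 0) (1 / 2, 1 / 2)
    (fun h => hr.ne' (congrArg Prod.fst h)) (s := 1 / 2) (t := 1 / 4)
    (by norm_num) (by norm_num)
  refine ⟨T, ?_⟩
  convert! isAnchoredNormalized_ellipse using 1
  have hpt : ∀ a b : ℝ, c + a • ((r, 0) : ℝ × ℝ) + b • turn (r, 0) = (c.1 + r * a, c.2 + r * b) :=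
    fun a b => by ext <;> simp [turn] <;> ring
  simp only [hpt] at hT
  ext z
  constructor
  · rintro ⟨p, (hp : _ = _), rfl⟩
    have h := hT ((p.1 - c.1) / r) ((p.2 - c.2) / r)
    rw [mul_div_cancel₀ _ hr.ne', mul_div_cancel₀ _ hr.ne', add_sub_cancel, add_sub_cancel] at h
    rw [show T p = _ from h]
    simp only [mem_ofPred_eq]
    field_simp
    linear_combination 4 * hp
  · rintro (hz : _ = _)
    refine ⟨_, ?_, (hT (2 * z.1 - 1) (4 * z.2 - 2)).trans (by ext <;> dsimp <;> ring)⟩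
    simp only [circle, mem_ofPred_eq]
    linear_combination r ^ 2 * hz

/-! ### From forced colors to the chromatic number -/

/-- A triangle-free family of copies of `X` every proper coloring of which uses a color `≥ k`. -/
lemma exists_triangleFree_of_normalized {X : Set (ℝ × ℝ)} (hX : IsAnchoredNormalized X) (k : ℕ) :
    ∃ F : Set (Set (ℝ × ℝ)), F.Finite ∧ (∀ Y ∈ F, IsHomotheticCopy X Y) ∧ TriangleFree F ∧
      ∀ c, IsProper F c → ∃ A ∈ F, k ≤ c A := by
  obtain ⟨F, 𝓟, hF, hk⟩ := exists_configuration_forcing hX (k + 1) 1 one_pos le_rfl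
  refine ⟨F, hF.finite, hF.copy, hF.triangleFree, fun c hc => ?_⟩
  by_contra! hcon
  obtain ⟨P, -, hP⟩ := hk c hc
  have hsub : c '' {Y ∈ F | P.Stabbed Y} ⊆ (Finset.range k : Set ℕ) := by
    rintro _ ⟨Y, ⟨hY, -⟩, rfl⟩
    simpa using hcon Y hY
  have h := hP.trans (encard_le_encard hsub)
  rw [encard_coe_eq_coe_finsetCard, Finset.card_range, Nat.cast_le] at h
  omega

lemma exists_triangleFree_of_isAnchored {X : Set (ℝ × ℝ)} (hX : IsAnchored X) (k : ℕ) :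
    ∃ F : Set (Set (ℝ × ℝ)), F.Finite ∧ (∀ Y ∈ F, IsHomotheticCopy X Y) ∧ TriangleFree F ∧
      ∀ c, IsProper F c → ∃ A ∈ F, k ≤ c A := by
  obtain ⟨T, hT⟩ := hX
  obtain ⟨F, hfin, hcopy, htri, hcol⟩ := exists_triangleFree_of_normalized hT k
  have hinj := T.symm.injective
  have hI : ∀ A B : Set (ℝ × ℝ), (T.symm '' A ∩ T.symm '' B).Nonempty ↔ (A ∩ B).Nonempty :=
    fun A B => by rw [← image_inter hinj, image_nonempty]
  refine ⟨(T.symm '' ·) '' F, hfin.image _, ?_, ?_, ?_⟩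
  · rintro _ ⟨Y, hY, rfl⟩
    obtain ⟨r, v, hr, rfl⟩ := hcopy Y hY
    -- Conjugating a homothety by an affine map preserves the ratio and changes only the
    -- translation.
    refine ⟨r, T.symm v - r • T.symm 0, hr, ?_⟩
    dsimp only
    rw [image_image, image_image]
    refine image_congr fun p _ => ?_
    have h1 : ∀ u, T.symm u = T.symm.linear u + T.symm 0 := fun u => by
      simpa using T.symm.map_vadd 0 u
    have h2 : p = T.symm.linear (T p) + T.symm 0 := by rw [← h1, T.symm_apply_apply]
    rw [h1 (r • T p + v), h1 v, map_add, map_smul]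
    conv_rhs => rw [h2]
    module
  · rintro _ ⟨A, hA, rfl⟩ _ ⟨B, hB, rfl⟩ _ ⟨C, hC, rfl⟩ hAB hAC hBC h1 h2 h3
    rw [hI] at h1 h2 h3
    exact htri A hA B hB C hC (fun h => hAB (h ▸ rfl)) (fun h => hAC (h ▸ rfl))
      (fun h => hBC (h ▸ rfl)) h1 h2 h3
  · intro c hc
    obtain ⟨A, hA, hk⟩ := hcol (fun Y => c (T.symm '' Y)) fun A hA B hB hAB h =>
      hc _ ⟨A, hA, rfl⟩ _ ⟨B, hB, rfl⟩ ((image_injective.2 hinj).ne hAB) ((hI A B).2 h)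
    exact ⟨_, ⟨A, hA, rfl⟩, hk⟩

lemma TriangleFree.cliqueFree {F : Set (Set (ℝ × ℝ))} (h : TriangleFree F) :
    (intersectionGraph F).CliqueFree 3 := by
  intro s hs
  obtain ⟨A, B, C, hAB, hAC, hBC, -⟩ := SimpleGraph.is3Clique_iff.1 hs
  exact h A A.2 B B.2 C C.2 (Subtype.coe_ne_coe.2 hAB.1) (Subtype.coe_ne_coe.2 hAC.1)
    (Subtype.coe_ne_coe.2 hBC.1) hAB.2 hAC.2 hBC.2

lemma lt_chromaticNumber {F : Set (Set (ℝ × ℝ))} {k : ℕ}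
    (h : ∀ c, IsProper F c → ∃ A ∈ F, k ≤ c A) :
    (k : ℕ∞) < (intersectionGraph F).chromaticNumber := by
  classical
  rw [← not_le, SimpleGraph.chromaticNumber_le_iff_colorable]
  rintro ⟨C⟩
  -- The value `0` outside `F` is irrelevant, since properness only concerns members of `F`.
  obtain ⟨A, hA, hk⟩ := h (fun A => if hA : A ∈ F then (C ⟨A, hA⟩ : ℕ) else 0) (by
    intro A hA B hB hAB hI
    simp only [hA, hB, dif_pos]
    exact fun h => C.valid (v := ⟨A, hA⟩) (w := ⟨B, hB⟩)
      ⟨fun e => hAB (congrArg Subtype.val e), hI⟩ (Fin.ext h))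
  simp only [hA, dif_pos] at hk
  exact absurd (C ⟨A, hA⟩).2 (not_lt.2 hk)

end HomotheticCopies

theorem theorem3 :
    (∀ X : Set (ℝ × ℝ), HomotheticCopies.IsAnchored X → ∀ k : ℕ, 1 ≤ k →
      ∃ F : Set (Set (ℝ × ℝ)), F.Finite ∧
        (∀ Y ∈ F, HomotheticCopies.IsHomotheticCopy X Y) ∧
        (HomotheticCopies.intersectionGraph F).CliqueFree 3 ∧
        (k : ℕ∞) < (HomotheticCopies.intersectionGraph F).chromaticNumber) ∧
    (∀ (c : ℝ × ℝ) (r : ℝ), 0 < r →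
      HomotheticCopies.IsAnchored (HomotheticCopies.circle c r)) ∧
    (∀ c w : ℝ × ℝ, w ≠ 0 →
      HomotheticCopies.IsAnchored (HomotheticCopies.squareBoundary c w)) ∧
    (∀ c w : ℝ × ℝ, w ≠ 0 →
      HomotheticCopies.IsAnchored (HomotheticCopies.equilateralL c w)) := by
  refine ⟨fun X hX k _ => ?_, fun c r => HomotheticCopies.isAnchored_circle,
    fun c w => HomotheticCopies.isAnchored_squareBoundary,
    fun c w => HomotheticCopies.isAnchored_equilateralL⟩
  obtain ⟨F, hfin, hcopy, htri, hcol⟩ := HomotheticCopies.exists_triangleFree_of_isAnchored hX k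
  exact ⟨F, hfin, hcopy, htri.cliqueFree, HomotheticCopies.lt_chromaticNumber hcol⟩
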